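/- Let $n,r,d,k\ge 1$ be integers with $k\mid r$ and $k\mid d$. A labelled prepartition of $[n]=\{1,\dots,n\}$ is a triple $(I,\pi,\gamma)$, where $I\subseteq[n]$ (the zero block, possibly empty), $\pi$ is a partition of $[n]\setminus I$ into nonempty blocks, and $\gamma:[n]\setminus I\to\mathbb Z/r\mathbb Z$. Two prepartitions $(I,\pi,\gamma)$, $(I',\pi',\gamma')$ are equivalent if $I=I'$, $\pi=\pi'$, and on each block of $\pi$ the labellings $\gamma,\gamma'$ differ by an additive constant. The Dowling lattice $Q_n(r)$ is the set of equivalence classes $\overline{(I,\pi,\gamma)}$, with the partial order generated by the following merges: replace $I$ by $I\cup B$ for a block $B$ of $\pi$ (removing $B$ from $\pi$ and forgetting its labels), or replace two blocks $B\ne C$ of $\pi$ by $B\cup C$, after adding some constant $g\in\mathbb Z/r\mathbb Z$ to the labels on $C$. Its minimum $\hat 0$ has $I=\emptyset$ and all blocks singletons. Let $Q_n(r,d,k)$ be the subposet of $Q_n(r)$ consisting of $\hat 0$ and of all $\overline{(I,\pi,\gamma)}$ such that every block $B$ of $\pi$ has size divisible by $d$ and the number of $a\in B$ with $\gamma(a)\equiv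 j\pmod k$ is independent of $j$. Write $|\pi|$ for the number of blocks of $\pi$. A bounded poset $P$ admits a recursive atom ordering if it has length $1$ (its single atom $\hat 1$ then being the ordering), or if it has length greater than $1$ and its atoms can be ordered $a_1,\dots,a_t$ so that (i) for every $j$ the interval $[a_j,\hat 1]$ admits a recursive atom ordering in which the atoms belonging to $[a_i,\hat 1]$ for some $i<j$ come first, and (ii) whenever $i<j$ and $a_i,a_j<y$, there are $l<j$ and an atom $z$ of $[a_j,\hat 1]$ with $a_l<z\le y$. Then $Q_n(r,d,k)$ is a lattice; it is pure (all its maximal chains have the same length); and it admits a recursive atom ordering. The ordering of its atoms can be chosen lexicographic on block words: the words of $a_1,a_2,\dots,a_t$ are weakly increasing in the lexicographic order, where the word of $\overline{(I,\pi,\gamma)}$ lists the elements of $I$ in increasing order, followed by the blocks of $\pi$ in the order of their smallest elements, each block listed in increasing order. The rank function (the length of the interval from $\hat 0$) is given by $\operatorname{rk}(\hat 0)=0$ and, for $\overline{(I,\pi,\gamma)}\neq\hat 0$, $$\operatorname{rk}\,\overline{(I,\pi,\gamma)}=\begin{cases}\lfloor n/d\rfloor+1-|\pi| & \text{if } d\ge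 2,\\ n-|\pi| & \text{if } d=1.\end{cases}$$ -/

import Mathlib

/-! ### Bounded posets: lattices, purity, recursive atom orderings -/

/-- Every two elements of `P` have a join and a meet. -/
def IsLatticePoset (P : Type*) [PartialOrder P] : Prop :=
  ∀ x y : P, (∃ z, IsLUB {x, y} z) ∧ (∃ z, IsGLB {x, y} z)

/-- All maximal chains of `P` have the same finite length `N`, that is, `N + 1` elements. -/
def IsPurePoset (P : Type*) [PartialOrder P] : Prop :=
  ∃ N : ℕ, ∀ c : Set P, IsMaxChain (· ≤ ·) c → c.encard = N + 1

/-- `IsRecursiveAtomOrdering x a`: the finite sequence `a` is a recursive atom ordering of the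
interval `[x, ⊤]`. The atoms of `[x, ⊤]` are the elements `y` with `x ⋖ y`. The interval has
length `1` exactly if `x ⋖ ⊤`, and length greater than `1` exactly if `x < w < ⊤` for some `w`.
The intervals `[a j, ⊤]` of `[x, ⊤]` are again intervals of `P`. -/
inductive IsRecursiveAtomOrdering {P : Type*} [PartialOrder P] [BoundedOrder P] :
    P → {t : ℕ} → (Fin t → P) → Prop
  | length_one (x : P) (t : ℕ) (a : Fin t → P)
      (hx : x ⋖ ⊤)
      (inj : Function.Injective a)
      (atoms : Set.range a = {y | x ⋖ y}) :
      IsRecursiveAtomOrdering x a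
  | step (x : P) (t : ℕ) (a : Fin t → P)
      (hx : ∃ w, x < w ∧ w < ⊤)
      (inj : Function.Injective a)
      (atoms : Set.range a = {y | x ⋖ y})
      (s : Fin t → ℕ) (b : ∀ j, Fin (s j) → P)
      (upper : ∀ j, IsRecursiveAtomOrdering (a j) (b j))
      (first : ∀ j p q, (∃ i < j, a i ≤ b j p) → (¬ ∃ i < j, a i ≤ b j q) → p < q)
      (common : ∀ i j, i < j → ∀ y, a i < y → a j < y →
        ∃ k < j, ∃ z, a j ⋖ z ∧ a k < z ∧ z ≤ y) :
      IsRecursiveAtomOrdering x a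

/-! ### The Dowling lattice of the cyclic group `ℤ/r` -/

/-- A prepartition `(I, π, γ)` of `{1, …, n}` (here `Fin n`) labelled by the cyclic group `ℤ/r`:
a zero block `I`, a partition `π` of the complement of `I` into nonempty blocks, and a labelling
`γ` of the complement of `I`. The values of `γ` on `I` carry no information: they are ignored by
the equivalence below. -/
structure PrePartition (n r : ℕ) where
  zero : Finset (Fin n)
  part : Finpartition zeroᶜ
  label : Fin n → ZMod r

namespace PrePartition

variable {n r : ℕ}

/-- The nonzero blocks. -/
def blocks (p : PrePartition n r) : Finset (Finset (Fin n)) := p.part.parts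

/-- Equality of zero blocks, and a correspondence between nonzero blocks under which the labelled
blocks, as sets of pairs `(a, γ a)`, differ by a translation `(a, h) ↦ (a, h + g)`. -/
def Equivalent (p q : PrePartition n r) : Prop :=
  p.zero = q.zero ∧ p.blocks = q.blocks ∧
    ∀ B ∈ p.blocks, ∃ g : ZMod r, ∀ a ∈ B, q.label a = p.label a + g

instance setoid (n r : ℕ) : Setoid (PrePartition n r) where
  r := Equivalent
  iseqv :=
    { refl := fun p => ⟨rfl, rfl, fun B _ => ⟨0, fun a _ => by simp⟩⟩
      symm := fun {p q} h => ⟨h.1.symm, h.2.1.symm, fun B hB => by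
        obtain ⟨g, hg⟩ := h.2.2 B (h.2.1 ▸ hB)
        exact ⟨-g, fun a ha => by rw [hg a ha]; abel⟩⟩
      trans := fun {p q s} h h' => ⟨h.1.trans h'.1, h.2.1.trans h'.2.1, fun B hB => by
        obtain ⟨g, hg⟩ := h.2.2 B hB
        obtain ⟨g', hg'⟩ := h'.2.2 B (h.2.1 ▸ hB)
        exact ⟨g + g', fun a ha => by rw [hg' a ha, hg a ha]; abel⟩⟩ }

/-- `q` arises from `p` by merging the zero block with the nonzero block `B`. -/
def MergeZero (p q : PrePartition n r) : Prop :=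
  ∃ B ∈ p.blocks, q.zero = p.zero ∪ B ∧ q.blocks = p.blocks.erase B ∧
    ∀ a, a ∉ q.zero → q.label a = p.label a

/-- `q` arises from `p` by merging the nonzero blocks `B` and `C`, the latter translated by `g`. -/
def MergeNonzero (p q : PrePartition n r) : Prop :=
  ∃ B ∈ p.blocks, ∃ C ∈ p.blocks, B ≠ C ∧ ∃ g : ZMod r,
    q.zero = p.zero ∧ q.blocks = insert (B ∪ C) ((p.blocks.erase B).erase C) ∧
    (∀ a ∈ C, q.label a = p.label a + g) ∧
    ∀ a, a ∉ q.zero → a ∉ C → q.label a = p.label a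

/-- The sizes of all nonzero blocks are divisible by `d`. -/
def IsDivisible (d : ℕ) (p : PrePartition n r) : Prop :=
  ∀ B ∈ p.blocks, d ∣ B.card

/-- In every nonzero block, each residue class modulo `k` contains the same number of labels. -/
def IsEvenlyColoured (k : ℕ) (p : PrePartition n r) : Prop :=
  ∀ B ∈ p.blocks, ∀ i j : ℕ,
    (B.filter fun a => (p.label a).val ≡ i [MOD k]).card =
      (B.filter fun a => (p.label a).val ≡ j [MOD k]).card

/-- The word listing the zero block in increasing order, followed by the nonzero blocks, each in
increasing order. The lists of the nonzero blocks are themselves sorted lexicographically, that is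
(as the blocks are disjoint and nonempty) by their smallest elements. -/
def word (p : PrePartition n r) : List (Fin n) :=
  p.zero.sort ++ ((p.blocks.image fun B => B.sort).sort).flatten

/-- The prepartition with empty zero block, all nonzero blocks singletons, all labels `0`. -/
def finest (n r : ℕ) : PrePartition n r := ⟨∅, ⊥, fun _ => 0⟩

/-- The prepartition whose zero block is everything. -/
def coarsest (n r : ℕ) : PrePartition n r :=
  ⟨Finset.univ, (Finpartition.empty (Finset (Fin n))).copy (by simp), fun _ => 0⟩

end PrePartition

/-- The set underlying the Dowling lattice `Q_n(r)`: labelled partitions, that is, equivalence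
classes of prepartitions. -/
def DowlingLattice (n r : ℕ) : Type := Quotient (PrePartition.setoid n r)

namespace DowlingLattice

variable {n r : ℕ}

/-- The class of a prepartition. -/
def mk (p : PrePartition n r) : DowlingLattice n r := Quotient.mk _ p

/-- `y` is obtained from `x` by merging two blocks. -/
def Merge (x y : DowlingLattice n r) : Prop :=
  ∃ p q : PrePartition n r, mk p = x ∧ mk q = y ∧ (p.MergeZero q ∨ p.MergeNonzero q)

/-- The number `|π|` of nonzero blocks. -/
def numBlocks (x : DowlingLattice n r) : ℕ :=
  Quotient.lift (fun p : PrePartition n r => p.blocks.card)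
    (fun p q (h : p.Equivalent q) => congrArg Finset.card h.2.1) x

/-- The block word. -/
def word (x : DowlingLattice n r) : List (Fin n) :=
  Quotient.lift (fun p : PrePartition n r => p.word)
    (fun p q (h : p.Equivalent q) => by simp only [PrePartition.word]; rw [h.1, h.2.1]) x

theorem Merge.numBlocks_eq {x y : DowlingLattice n r} (h : Merge x y) :
    x.numBlocks = y.numBlocks + 1 := by
  obtain ⟨p, q, rfl, rfl, h⟩ := h
  change p.blocks.card = q.blocks.card + 1
  rcases h with ⟨B, hB, -, hq, -⟩ | ⟨B, hB, C, hC, hBC, g, -, hq, -⟩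
  · rw [hq, Finset.card_erase_add_one hB]
  · have hC' : C ∈ p.blocks.erase B := Finset.mem_erase.2 ⟨hBC.symm, hC⟩
    have hn : B ∪ C ∉ (p.blocks.erase B).erase C := by
      intro hm
      have hm1 := Finset.mem_of_mem_erase (Finset.mem_of_mem_erase hm)
      have hne : B ∪ C ≠ B := (Finset.mem_erase.1 (Finset.mem_of_mem_erase hm)).1
      have hd : Disjoint (B ∪ C) B := p.part.disjoint hm1 hB hne
      obtain ⟨a, ha⟩ := p.part.nonempty_of_mem_parts hB
      exact Finset.disjoint_left.1 hd (Finset.mem_union_left _ ha) ha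
    rw [hq, Finset.card_insert_of_notMem hn, Finset.card_erase_add_one hC',
      Finset.card_erase_add_one hB]

theorem numBlocks_le_of_reflTransGen {x y : DowlingLattice n r}
    (h : Relation.ReflTransGen Merge x y) : y.numBlocks ≤ x.numBlocks := by
  induction h with
  | refl => exact le_rfl
  | tail _ h ih => have := h.numBlocks_eq; omega

/-- The partial order generated by the merges. -/
instance : PartialOrder (DowlingLattice n r) where
  le := Relation.ReflTransGen Merge
  le_refl _ := Relation.ReflTransGen.refl
  le_trans _ _ _ h h' := h.trans h'
  le_antisymm x y h h' := by
    rcases Relation.ReflTransGen.cases_tail h with h | ⟨z, hxz, hzy⟩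
    · exact h.symm
    · have h1 := numBlocks_le_of_reflTransGen hxz
      have h2 := hzy.numBlocks_eq
      have h3 := numBlocks_le_of_reflTransGen h'
      omega

/-- The element `0̂`. -/
instance : Bot (DowlingLattice n r) := ⟨mk (PrePartition.finest n r)⟩

/-- The element `1̂`. -/
instance : Top (DowlingLattice n r) := ⟨mk (PrePartition.coarsest n r)⟩

theorem numBlocks_le (x : DowlingLattice n r) : x.numBlocks ≤ n := by
  induction x using Quotient.inductionOn with
  | h p =>
    calc p.part.parts.card ≤ p.zeroᶜ.card := p.part.card_parts_le_card
      _ ≤ (Finset.univ : Finset (Fin n)).card := Finset.card_le_card (Finset.subset_univ _)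
      _ = n := by simp

/-- Removing a block from a partition. -/
def removeBlock {S T : Finset (Fin n)} (P : Finpartition S) {B : Finset (Fin n)}
    (hB : B ∈ P.parts) (hT : S \ B = T) : Finpartition T :=
  P.ofSubset (parts := P.parts.erase B) (Finset.erase_subset _ _) (by
    subst hT
    ext a
    simp only [Finset.mem_sup, Finset.mem_erase, id, Finset.mem_sdiff]
    constructor
    · rintro ⟨C, ⟨hCB, hC⟩, ha⟩
      exact ⟨P.le hC ha, fun haB =>
        Finset.disjoint_left.1 (P.disjoint hC hB hCB) ha haB⟩
    · rintro ⟨haS, haB⟩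
      obtain ⟨C, hC, ha⟩ := P.exists_mem haS
      exact ⟨C, ⟨fun h => haB (h ▸ ha), hC⟩, ha⟩)

theorem le_top' (x : DowlingLattice n r) : x ≤ ⊤ := by
  induction hm : x.numBlocks generalizing x with
  | zero =>
    induction x using Quotient.inductionOn with
    | h p =>
      have h0 : p.part.parts = ∅ := Finset.card_eq_zero.1 hm
      have h1 : p.zeroᶜ = ∅ := p.part.parts_eq_empty_iff.1 h0
      have : mk p = ⊤ := Quotient.sound
        ⟨(by simpa using h1 : p.zero = Finset.univ), h0, fun B hB => by
          change B ∈ p.part.parts at hB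
          rw [h0] at hB; simp at hB⟩
      exact this.le
  | succ m ih =>
    induction x using Quotient.inductionOn with
    | h p =>
      have h0 : p.part.parts.card = m + 1 := hm
      obtain ⟨B, hB⟩ := Finset.card_pos.1 (by omega : 0 < p.part.parts.card)
      let q : PrePartition n r := ⟨p.zero ∪ B, removeBlock p.part hB (by ext a; simp), p.label⟩
      have hM : Merge (mk p) (mk q) :=
        ⟨p, q, rfl, rfl, Or.inl ⟨B, hB, rfl, rfl, fun _ _ => rfl⟩⟩
      have h2 := hM.numBlocks_eq
      have h3 : (mk p).numBlocks = m + 1 := hm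
      exact Relation.ReflTransGen.head hM (ih (mk q) (by omega))

theorem exists_merge_or_eq_bot (p : PrePartition n r) :
    (∃ q : PrePartition n r, Merge (mk q) (mk p)) ∨ mk p = ⊥ := by
  by_cases hz : p.zero.Nonempty
  · obtain ⟨a, ha⟩ := hz
    let q : PrePartition n r := ⟨p.zero.erase a,
      p.part.extend (b := {a}) (by simp) (by simpa using ha)
        (by
          ext b
          by_cases hb : b = a <;> simp [hb]), p.label⟩
    have hna : {a} ∉ p.part.parts := fun h => by
      have := p.part.le h (Finset.mem_singleton_self a)
      simp [ha] at this
    refine Or.inl ⟨q, q, p, rfl, rfl, Or.inl ⟨{a}, Finset.mem_insert_self _ _, ?_, ?_,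
      fun _ _ => rfl⟩⟩
    · ext b
      by_cases hb : b = a <;> simp [q, hb, ha]
    · exact (Finset.erase_insert hna).symm
  · by_cases hc : ∃ B ∈ p.part.parts, 1 < B.card
    · obtain ⟨B, hB, hcard⟩ := hc
      obtain ⟨a, ha⟩ := Finset.card_pos.1 (by omega : 0 < B.card)
      have hE : (B.erase a).Nonempty := by
        rw [← Finset.card_pos, Finset.card_erase_of_mem ha]; omega
      have hBz : B ⊆ p.zeroᶜ := p.part.le hB
      let P0 := removeBlock p.part hB rfl
      let P1 := P0.extend (b := B.erase a) (c := p.zeroᶜ.erase a) hE.ne_empty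
        (Finset.disjoint_left.2 fun b hb hb' =>
          (Finset.mem_sdiff.1 hb).2 (Finset.mem_of_mem_erase hb'))
        (by
          ext b
          have h1 : b ∈ B → b ∈ p.zeroᶜ := fun h => hBz h
          have h2 : b = a → b ∈ B := fun h => h ▸ ha
          simp only [Finset.sup_eq_union, Finset.mem_union, Finset.mem_sdiff, Finset.mem_erase]
          tauto)
      let P2 := P1.extend (b := {a}) (c := p.zeroᶜ) (by simp) (by simp)
        (by
          ext b
          have h2 : b = a → b ∈ p.zeroᶜ := fun h => h ▸ hBz ha
          simp only [Finset.sup_eq_union, Finset.mem_union, Finset.mem_singleton,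
            Finset.mem_erase]
          tauto)
      let q : PrePartition n r := ⟨p.zero, P2, p.label⟩
      have hq : q.blocks = insert {a} (insert (B.erase a) (p.part.parts.erase B)) := rfl
      have hn1 : {a} ∉ p.part.parts.erase B := fun h => by
        have h' := Finset.mem_erase.1 h
        exact Finset.disjoint_left.1 (p.part.disjoint h'.2 hB h'.1)
          (Finset.mem_singleton_self a) ha
      have hn2 : B.erase a ∉ p.part.parts.erase B := fun h => by
        have h' := Finset.mem_erase.1 h
        obtain ⟨b, hb⟩ := hE
        exact Finset.disjoint_left.1 (p.part.disjoint h'.2 hB h'.1) hb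
          (Finset.mem_of_mem_erase hb)
      have hne : {a} ≠ B.erase a := fun h => by
        have : a ∈ B.erase a := h ▸ Finset.mem_singleton_self a
        simp at this
      refine Or.inl ⟨q, q, p, rfl, rfl, Or.inr ⟨{a}, ?_, B.erase a, ?_, hne, 0, rfl, ?_, ?_, ?_⟩⟩
      · rw [hq]; exact Finset.mem_insert_self _ _
      · rw [hq]; exact Finset.mem_insert_of_mem (Finset.mem_insert_self _ _)
      · have hU : {a} ∪ B.erase a = B := by
          rw [← Finset.insert_eq, Finset.insert_erase ha]
        rw [hq, hU, Finset.erase_insert (by simp [hne, hn1]), Finset.erase_insert hn2,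
          Finset.insert_erase hB]
        rfl
      · intro b _; simp [q]
      · intro b _ _; rfl
    · have hz' : p.zero = ∅ := Finset.not_nonempty_iff_eq_empty.1 hz
      push Not at hc
      have hone : ∀ B ∈ p.part.parts, ∃ a, B = {a} := fun B hB =>
        Finset.card_eq_one.1 (le_antisymm (hc B hB)
          (Finset.card_pos.2 (p.part.nonempty_of_mem_parts hB)))
      refine Or.inr (Quotient.sound ⟨hz', ?_, ?_⟩)
      · change p.part.parts = (⊥ : Finpartition (∅ᶜ : Finset (Fin n))).parts
        ext B
        rw [Finpartition.mem_bot_iff]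
        constructor
        · intro hB
          obtain ⟨a, rfl⟩ := hone B hB
          exact ⟨a, by simp, rfl⟩
        · rintro ⟨a, -, rfl⟩
          obtain ⟨C, hC, ha⟩ := p.part.exists_mem (a := a) (by simp [hz'])
          obtain ⟨b, rfl⟩ := hone C hC
          rw [Finset.mem_singleton.1 ha]
          exact hC
      · intro B hB
        obtain ⟨a, rfl⟩ := hone B hB
        refine ⟨- p.label a, fun b hb => ?_⟩
        rw [Finset.mem_singleton.1 hb]
        simp [PrePartition.finest]

theorem bot_le' (x : DowlingLattice n r) : ⊥ ≤ x := by
  induction hm : n - x.numBlocks generalizing x with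
  | zero =>
    induction x using Quotient.inductionOn with
    | h p =>
      rcases exists_merge_or_eq_bot p with ⟨q, hq⟩ | h
      · have h1 := hq.numBlocks_eq
        have h2 := (mk q).numBlocks_le
        have h3 : n - (mk p).numBlocks = 0 := hm
        omega
      · exact h.symm.le
  | succ m ih =>
    induction x using Quotient.inductionOn with
    | h p =>
      rcases exists_merge_or_eq_bot p with ⟨q, hq⟩ | h
      · have h1 := hq.numBlocks_eq
        have h3 : n - (mk p).numBlocks = m + 1 := hm
        exact Relation.ReflTransGen.tail (ih (mk q) (by omega)) hq
      · exact h.symm.le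

instance : BoundedOrder (DowlingLattice n r) where
  le_top := le_top'
  bot_le := bot_le'

end DowlingLattice

/-- The `k`-evenly coloured, `d`-divisible Dowling lattice `Q_n(r,d,k)`, with the order induced
from `Q_n(r)`. For `k ∣ r` both conditions do not depend on the representative `p`. -/
def EvenDowlingLattice (n r d k : ℕ) : Type :=
  {x : DowlingLattice n r // x = ⊥ ∨
    ∃ p : PrePartition n r, DowlingLattice.mk p = x ∧ p.IsDivisible d ∧ p.IsEvenlyColoured k}

namespace EvenDowlingLattice

variable {n r d k : ℕ}

instance : PartialOrder (EvenDowlingLattice n r d k) :=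
  inferInstanceAs (PartialOrder {x : DowlingLattice n r // x = ⊥ ∨
    ∃ p : PrePartition n r, DowlingLattice.mk p = x ∧ p.IsDivisible d ∧ p.IsEvenlyColoured k})

instance : BoundedOrder (EvenDowlingLattice n r d k) where
  bot := ⟨⊥, Or.inl rfl⟩
  bot_le x := (bot_le : ⊥ ≤ x.1)
  top := ⟨⊤, Or.inr ⟨PrePartition.coarsest n r, rfl, fun B hB => absurd hB (by
    change B ∉ (∅ : Finset (Finset (Fin n))); simp), fun B hB => absurd hB (by
    change B ∉ (∅ : Finset (Finset (Fin n))); simp)⟩⟩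
  le_top x := (le_top : x.1 ≤ ⊤)

/-- The number `|π|` of nonzero blocks. -/
def numBlocks (x : EvenDowlingLattice n r d k) : ℕ := x.1.numBlocks

/-- The block word. -/
def word (x : EvenDowlingLattice n r d k) : List (Fin n) := x.1.word

end EvenDowlingLattice

/-!
The nonminimal elements of `Q_n(r, d, k)` form an upper set of the Dowling lattice `Q_n(r)`: merging
blocks preserves divisibility and even colouring. So everything above `0̂` is governed by `Q_n(r)`.

The order of `Q_n(r)`, generated by merges, is refinement (`DowlingLattice.mk_le_mk`). Lying in the
zero block, or being linked to another element with a prescribed difference of labels, are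
conditions whose imposition on any element costs at most one merge
(`exists_least_mem_zero`, `exists_least_linked`), and every merge imposes such a condition. Hence
joins exist and `Q_n(r)` is semimodular (`exists_merge_of_merge`), so that for `x ≠ 0̂` every
ordering of the atoms of `[x, 1̂]` is a recursive atom ordering; for `d = 1` this holds for `x = 0̂`
as well, `Q_n(r, 1, 1)` being all of `Q_n(r)`. Meets come for free in a finite poset with
joins and a minimum.

An admissible element with fewer than `⌊n/d⌋` nonzero blocks can be refined by splitting off a block
of size `d`, so covers change the rank by exactly one; this gives the rank function and purity.

It remains to order the atoms above `0̂` for `d ≥ 2`. They are compared by their zero blocks, then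
by their lists of blocks, then by normalized labels. Suppose that the atom `p'` precedes the atom `p`,
and that both lie below `q`. Then `p` has a cover below `q` that lies above an atom preceding `p`
(`hasExchange_of_key_lt`):
* if the zero blocks differ, the first element `e` of the zero block of `p'` that is not in the zero
  block of `p` changes places with a larger element of the latter, and the block of `e` is merged
  into the zero block;
* if the zero blocks agree but the other blocks differ, the first differing blocks `A` of `p'` and
  `B` of `p` have the same minimum, and the first element `e` of `A` that is not in `B` changes
  places with a larger element of `B` of the same colour, which exists since `A` and `B` are evenly
  coloured of the same size; the blocks `B` and that of `e` are merged;
* if only the labels differ, the first block on which they differ lies in the zero block of `q`; it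
  takes the labels of `p'`, and it is merged into the zero block.
-/

/-! ### Finite posets: meets, ranks, atom orderings -/

/-- A finite set is enumerated without repetition so that a given key is weakly increasing. -/
theorem exists_monotone_enumeration {P L : Type*} [Finite P] [LinearOrder L] (A : Set P)
    (κ : P → L) : ∃ (t : ℕ) (a : Fin t → P),
      Function.Injective a ∧ Set.range a = A ∧ ∀ i j, i ≤ j → κ (a i) ≤ κ (a j) := by
  classical
  let e := (Finite.equivFin A).symm
  let f : Fin (Nat.card A) → L := fun i => κ (e i)
  refine ⟨Nat.card A, fun i => (e (Tuple.sort f i) : P), ?_, ?_, ?_⟩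
  · intro i j h
    exact (Tuple.sort f).injective (e.injective (Subtype.ext h))
  · ext x
    constructor
    · rintro ⟨i, rfl⟩
      exact (e _).2
    · intro hx
      refine ⟨(Tuple.sort f).symm (e.symm ⟨x, hx⟩), ?_⟩
      have h : Tuple.sort f ((Tuple.sort f).symm (e.symm ⟨x, hx⟩)) = e.symm ⟨x, hx⟩ :=
        Equiv.apply_symm_apply _ _
      simp only [h, Equiv.apply_symm_apply]
  · intro i j hij
    exact Tuple.monotone_sort f hij

/-- In a finite poset with a minimum, meets come for free: the meet is the maximal common lower
bound, which is unique since common lower bounds have joins. -/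
theorem isLatticePoset_of_exists_isLUB {P : Type*} [PartialOrder P] [OrderBot P] [Finite P]
    (h : ∀ x y : P, ∃ z, IsLUB {x, y} z) : IsLatticePoset P := by
  refine fun x y => ⟨h x y, ?_⟩
  obtain ⟨m, hm⟩ := (Set.toFinite (lowerBounds ({x, y} : Set P))).exists_maximal
    ⟨⊥, fun _ _ => bot_le⟩
  refine ⟨m, hm.prop, fun w hw => ?_⟩
  obtain ⟨z, hz⟩ := h m w
  have hzb : z ∈ lowerBounds ({x, y} : Set P) := fun v hv => hz.2 (by
    rintro u (rfl | rfl)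
    · exact hm.prop hv
    · exact hw hv)
  exact (hz.1 (by simp)).trans (hm.le_of_ge hzb (hz.1 (by simp)))

theorem isLUB_pair_iff {P : Type*} [PartialOrder P] {x m w : P} :
    IsLUB {x, m} w ↔ ∀ y, w ≤ y ↔ x ≤ y ∧ m ≤ y := by
  rw [isLUB_iff_le_iff]
  simp

section Rank

variable {P : Type*} [PartialOrder P] [BoundedOrder P] [Finite P] {ρ : P → ℕ}

theorem height_eq_of_rank (hρ : StrictMono ρ) (h0 : ρ ⊥ = 0)
    (hgap : ∀ x y, x < y → ρ x + 1 < ρ y → ∃ z, x < z ∧ z < y) (x : P) :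
    Order.height x = ρ x := by
  apply le_antisymm
  · simpa using Order.height_le_height_apply_of_strictMono ρ hρ x
  · induction hm : ρ x generalizing x with
    | zero => simp
    | succ m ih =>
      have hx : ⊥ < x := bot_lt_iff_ne_bot.2 (by rintro rfl; omega)
      obtain ⟨y, hy⟩ := (Set.toFinite (Set.Iio x)).exists_maximal ⟨⊥, hx⟩
      have hyx : y < x := hy.prop
      have h1 : ¬ ρ y + 1 < ρ x := fun h => by
        obtain ⟨z, hyz, hzx⟩ := hgap y x hyx h
        exact hyz.not_ge (hy.le_of_ge (y := z) hzx hyz.le)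
      have h2 := hρ hyx
      have h3 := ih y (by omega)
      calc ((m + 1 : ℕ) : ℕ∞) = (m : ℕ∞) + 1 := by push_cast; rfl
        _ ≤ Order.height y + 1 := by gcongr
        _ ≤ Order.height x := Order.height_add_one_le hyx

theorem isPurePoset_of_rank (hρ : StrictMono ρ) (h0 : ρ ⊥ = 0)
    (hgap : ∀ x y, x < y → ρ x + 1 < ρ y → ∃ z, x < z ∧ z < y) : IsPurePoset P := by
  refine ⟨ρ ⊤, fun c hc => ?_⟩
  have hinj : Set.InjOn ρ c := fun x hx y hy hxy => by
    by_contra hne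
    rcases hc.1.total hx hy with h | h
    · exact (hρ (lt_of_le_of_ne h hne)).ne hxy
    · exact (hρ (lt_of_le_of_ne h (Ne.symm hne))).ne' hxy
  have himg : ρ '' c = Set.Iio (ρ ⊤ + 1) := by
    ext m
    constructor
    · rintro ⟨x, -, rfl⟩
      exact Nat.lt_succ_of_le (hρ.monotone le_top)
    · intro hm
      have hm' : m ≤ ρ ⊤ := Nat.le_of_lt_succ hm
      by_contra hno
      have hne : ∀ x ∈ c, ρ x ≠ m := fun x hx h => hno ⟨x, hx, h⟩
      -- A skipped rank leaves a gap in the chain, which an intermediate element would fill.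
      obtain ⟨x, hx⟩ := (Set.toFinite {x | x ∈ c ∧ ρ x < m}).exists_maximal
        ⟨⊥, hc.bot_mem, by
          have := hne _ hc.bot_mem
          omega⟩
      obtain ⟨y, hy⟩ := (Set.toFinite {x | x ∈ c ∧ m < ρ x}).exists_minimal
        ⟨⊤, hc.top_mem, by
          have := hne _ hc.top_mem
          omega⟩
      have hxm : ρ x < m := hx.prop.2
      have hym : m < ρ y := hy.prop.2
      have hxy : x < y := by
        rcases hc.1.total hx.prop.1 hy.prop.1 with h | h
        · exact lt_of_le_of_ne h (by rintro rfl; omega)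
        · have := hρ.monotone h
          omega
      obtain ⟨z, hxz, hzy⟩ := hgap x y hxy (by omega)
      have hzc : z ∈ c := by
        have hins : IsChain (· ≤ ·) (insert z c) := hc.1.insert fun w hw _ => by
          rcases lt_or_gt_of_ne (hne w hw) with h | h
          · right
            rcases hc.1.total hw hx.prop.1 with h' | h'
            · exact h'.trans hxz.le
            · exact (hx.le_of_ge (y := w) ⟨hw, h⟩ h').trans hxz.le
          · left
            rcases hc.1.total hw hy.prop.1 with h' | h'
            · exact hzy.le.trans (hy.le_of_le (y := w) ⟨hw, h⟩ h')
            · exact hzy.le.trans h'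
        rw [hc.2 hins (Set.subset_insert _ _)]
        exact Set.mem_insert _ _
      rcases lt_or_gt_of_ne (hne z hzc) with h | h
      · exact hxz.not_ge (hx.le_of_ge (y := z) ⟨hzc, h⟩ hxz.le)
      · exact hzy.not_ge (hy.le_of_le (y := z) ⟨hzc, h⟩ hzy.le)
  rw [← hinj.encard_image, himg, ← Finset.coe_Iio, Set.encard_coe_eq_coe_finsetCard]
  simp

end Rank

/-- The condition on upper intervals in a recursive atom ordering holds as soon as every enumeration
of the atoms of these intervals is a recursive atom ordering. -/
theorem isRecursiveAtomOrdering_of_forall {P : Type*} [PartialOrder P] [BoundedOrder P]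
    [Finite P] {x : P} (hx : x ≠ ⊤) {t : ℕ} {a : Fin t → P} (inj : Function.Injective a)
    (atoms : Set.range a = {y | x ⋖ y})
    (upper : ∀ y, x ⋖ y → y ≠ ⊤ → ∀ (s : ℕ) (b : Fin s → P), Function.Injective b →
      Set.range b = {z | y ⋖ z} → IsRecursiveAtomOrdering y b)
    (common : ∀ i j, i < j → ∀ y, a i < y → a j < y →
      ∃ k < j, ∃ z, a j ⋖ z ∧ a k < z ∧ z ≤ y) :
    IsRecursiveAtomOrdering x a := by
  classical
  by_cases hcov : x ⋖ ⊤
  · exact .length_one x t a hcov inj atoms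
  have hcovers : ∀ j, x ⋖ a j := fun j => by
    have : a j ∈ {y | x ⋖ y} := atoms ▸ Set.mem_range_self j
    exact this
  have hw : ∃ w, x < w ∧ w < ⊤ := by
    by_contra hno
    push Not at hno
    exact hcov ⟨lt_top_iff_ne_top.2 hx, fun w h1 h2 => hno w h1 h2⟩
  -- The atoms of `[a j, ⊤]` that lie above an earlier atom get the smaller key.
  choose s b hbinj hbrange hbmono using fun j : Fin t =>
    exists_monotone_enumeration {y | a j ⋖ y} fun y => if ∃ i < j, a i ≤ y then 0 else 1
  refine .step x t a hw inj atoms s b (fun j => ?_) (fun j p q hp hq => ?_) common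
  · exact upper (a j) (hcovers j) (fun h => hcov (h ▸ hcovers j)) (s j) (b j) (hbinj j) (hbrange j)
  · by_contra hpq
    have := hbmono j q p (not_lt.1 hpq)
    simp [if_pos hp, if_neg hq] at this

/-- In an upper interval that is semimodular (two elements covering the same element `x'` have a
common upper bound that covers one of them, below any given one), every enumeration of the atoms is
a recursive atom ordering. -/
theorem isRecursiveAtomOrdering_of_semimodular {P : Type*} [PartialOrder P] [BoundedOrder P]
    [Finite P] (x : P) (hx : x ≠ ⊤)
    (hsemi : ∀ x' a b y, x ≤ x' → x' ⋖ a → x' ⋖ b → a ≠ b → a ≤ y → b ≤ y →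
      ∃ z, a ⋖ z ∧ b < z ∧ z ≤ y)
    (t : ℕ) (a : Fin t → P) (inj : Function.Injective a) (atoms : Set.range a = {y | x ⋖ y}) :
    IsRecursiveAtomOrdering x a := by
  induction x using WellFoundedGT.induction generalizing t with
  | ind x ih =>
  have hcovers : ∀ j, x ⋖ a j := fun j => by
    have : a j ∈ {y | x ⋖ y} := atoms ▸ Set.mem_range_self j
    exact this
  refine isRecursiveAtomOrdering_of_forall hx inj atoms (fun y hxy hy s b hinj hrange => ?_)
    (fun i j hij y hi hj => ?_)
  · exact ih y hxy.lt hy (fun x' a' b' y' hx' => hsemi x' a' b' y' (hxy.le.trans hx'))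
      s b hinj hrange
  · obtain ⟨z, h1, h2, h3⟩ := hsemi x (a j) (a i) y le_rfl (hcovers j) (hcovers i)
      (fun h => hij.ne' (inj h)) hj.le hi.le
    exact ⟨i, hij, z, h1, h2, h3⟩

/-! ### Lexicographic comparison of sorted lists -/

/-- Strictly increasing lists of the same length are compared by the smallest entry that belongs to
only one of them. -/
theorem List.lt_iff_exists_of_pairwise_lt {α : Type*} [LinearOrder α] :
    ∀ {l l' : List α}, l.Pairwise (· < ·) → l'.Pairwise (· < ·) → l.length = l'.length →
      (l < l' ↔ ∃ e ∈ l, e ∉ l' ∧ ∀ x < e, (x ∈ l ↔ x ∈ l'))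
  | [], [], _, _, _ => by simp
  | a :: l, b :: l', hl, hl', hlen => by
    have ih := List.lt_iff_exists_of_pairwise_lt (List.pairwise_cons.1 hl).2
      (List.pairwise_cons.1 hl').2 (by simpa using hlen)
    have ha := (List.pairwise_cons.1 hl).1
    have hb := (List.pairwise_cons.1 hl').1
    rw [List.cons_lt_cons_iff, ih]
    constructor
    · rintro (hab | ⟨rfl, e, he, he', hx⟩)
      · refine ⟨a, by simp, ?_, fun x hx => ?_⟩
        · simp only [List.mem_cons, not_or]
          exact ⟨hab.ne, fun h => (hab.trans (hb a h)).false⟩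
        · simp only [List.mem_cons, hx.ne, (hx.trans hab).ne, false_or]
          exact ⟨fun h => ((ha x h).trans hx).false.elim,
            fun h => ((hb x h).trans (hx.trans hab)).false.elim⟩
      · refine ⟨e, by simp [he], ?_, fun x hxe => ?_⟩
        · simp [he', (ha e he).ne']
        · simp [hx x hxe]
    · rintro ⟨e, he, he', hx⟩
      simp only [List.mem_cons, not_or] at he he'
      rcases lt_trichotomy a b with hab | rfl | hab
      · exact Or.inl hab
      · refine Or.inr ⟨rfl, e, he.resolve_left he'.1, he'.2, fun x hxe => ?_⟩
        have h1 := hx x hxe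
        simp only [List.mem_cons] at h1
        by_cases hxa : x = a
        · subst hxa
          exact ⟨fun h => ((ha x h).false).elim, fun h => ((hb x h).false).elim⟩
        · simpa [hxa] using h1
      · exfalso
        have hae : a ≤ e := he.elim (fun h => h.ge) fun h => (ha e h).le
        have := (hx b (hab.trans_le hae)).2 (by simp)
        simp only [List.mem_cons] at this
        rcases this with h | h
        · exact hab.ne h
        · exact ((ha b h).trans hab).false
  | [], _ :: _, _, _, hlen => by simp at hlen
  | _ :: _, [], _, _, hlen => by simp at hlen

/-- The lexicographic order of the sorted lists of two finite sets of the same size: the smallest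
element of the symmetric difference belongs to the first set. -/
theorem Finset.sort_lt_sort_iff {α : Type*} [LinearOrder α] {S T : Finset α}
    (h : S.card = T.card) :
    S.sort < T.sort ↔ ∃ e ∈ S, e ∉ T ∧ ∀ x < e, (x ∈ S ↔ x ∈ T) := by
  rw [List.lt_iff_exists_of_pairwise_lt (Finset.sortedLT_sort S).pairwise
    (Finset.sortedLT_sort T).pairwise (by simp [h])]
  simp

theorem Finset.sort_injective {α : Type*} [LinearOrder α] :
    Function.Injective fun S : Finset α => S.sort := fun S T h => by
  classical
  have := congrArg List.toFinset h
  simpa using this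

theorem List.cons_le_cons_iff_of_linearOrder {α : Type*} [LinearOrder α] {a b : α}
    {l l' : List α} : a :: l ≤ b :: l' ↔ a < b ∨ a = b ∧ l ≤ l' := by
  rw [le_iff_lt_or_eq, le_iff_lt_or_eq, List.cons_lt_cons_iff, List.cons.injEq]
  tauto

theorem List.nil_le_of_linearOrder {α : Type*} [LinearOrder α] (l : List α) : [] ≤ l := by
  cases l with
  | nil => exact le_rfl
  | cons a l => exact (List.nil_lt_cons a l).le

theorem List.append_le_append_of_le {α : Type*} [LinearOrder α] {l₁ l₂ m₁ m₂ : List α}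
    (hlen : l₁.length = l₂.length) (h : l₁ < l₂ ∨ l₁ = l₂ ∧ m₁ ≤ m₂) :
    l₁ ++ m₁ ≤ l₂ ++ m₂ := by
  induction l₁ generalizing l₂ with
  | nil =>
    obtain rfl : l₂ = [] := by simpa [eq_comm] using hlen
    simpa using h
  | cons a l₁ ih =>
    obtain _ | ⟨b, l₂⟩ := l₂
    · simp at hlen
    · rw [List.cons_append, List.cons_append, List.cons_le_cons_iff_of_linearOrder]
      rw [List.cons_lt_cons_iff] at h
      rcases h with (h | ⟨rfl, h⟩) | ⟨h, hm⟩
      · exact Or.inl h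
      · exact Or.inr ⟨rfl, ih (by simpa using hlen) (Or.inl h)⟩
      · simp only [List.cons.injEq] at h
        exact Or.inr ⟨h.1, ih (by simpa using hlen) (Or.inr ⟨h.2, hm⟩)⟩

/-- Concatenating lists of lists whose entries all have the same length is monotone for the
lexicographic orders. -/
theorem List.flatten_le_flatten_of_le {α : Type*} [LinearOrder α] {d : ℕ} :
    ∀ {L M : List (List α)}, (∀ l ∈ L, l.length = d) → (∀ l ∈ M, l.length = d) → L ≤ M →
      L.flatten ≤ M.flatten
  | [], _, _, _, _ => List.nil_le_of_linearOrder _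
  | l :: L, [], _, _, h => absurd (List.nil_lt_cons l L) (not_lt.2 h)
  | l :: L, m :: M, hL, hM, h => by
    rw [List.cons_le_cons_iff_of_linearOrder] at h
    rw [List.flatten_cons, List.flatten_cons]
    refine List.append_le_append_of_le ((hL l (by simp)).trans (hM m (by simp)).symm)
      (h.imp id fun h => ⟨h.1, List.flatten_le_flatten_of_le (fun l hl => hL l (by simp [hl]))
        (fun l hl => hM l (by simp [hl])) h.2⟩)

/-! ### The order of the Dowling lattice -/

namespace PrePartition

variable {n r : ℕ}

theorem eq_of_mem_blocks {p : PrePartition n r} {B C : Finset (Fin n)} {a : Fin n}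
    (hB : B ∈ p.blocks) (hC : C ∈ p.blocks) (haB : a ∈ B) (haC : a ∈ C) : B = C :=
  p.part.eq_of_mem_parts hB hC haB haC

theorem exists_mem_blocks {p : PrePartition n r} {a : Fin n} (ha : a ∉ p.zero) :
    ∃ B ∈ p.blocks, a ∈ B :=
  p.part.exists_mem (by simpa using ha)

theorem notMem_zero_of_mem {p : PrePartition n r} {B : Finset (Fin n)} {a : Fin n}
    (hB : B ∈ p.blocks) (ha : a ∈ B) : a ∉ p.zero := by
  simpa using p.part.le hB ha

theorem nonempty_of_mem_blocks {p : PrePartition n r} {B : Finset (Fin n)}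
    (hB : B ∈ p.blocks) : B.Nonempty :=
  p.part.nonempty_of_mem_parts hB

/-- The prepartition with a given set of nonzero blocks; its zero block consists of the elements
that lie in none of them. -/
def ofBlocks (𝔅 : Finset (Finset (Fin n))) (hne : ∀ B ∈ 𝔅, B.Nonempty)
    (hdisj : ∀ B ∈ 𝔅, ∀ C ∈ 𝔅, ∀ a, a ∈ B → a ∈ C → B = C) (γ : Fin n → ZMod r) :
    PrePartition n r where
  zero := Finset.univ.filter fun a => ∀ B ∈ 𝔅, a ∉ B
  part :=
    { parts := 𝔅
      supIndep := by
        rw [Finset.supIndep_iff_pairwiseDisjoint]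
        intro B hB C hC hBC
        exact Finset.disjoint_left.2 fun a h h' => hBC (hdisj B hB C hC a h h')
      sup_parts := by
        ext a
        simp [Finset.mem_sup]
      bot_notMem := fun h => by simpa using hne _ h }
  label := γ

/-- A prepartition refines another one if its zero block is contained in the zero block of the
other, and each of its nonzero blocks is contained in the zero block of the other or, up to a
translation of the labels, in a nonzero block of the other. -/
def Refines (p q : PrePartition n r) : Prop :=
  p.zero ⊆ q.zero ∧ ∀ B ∈ p.blocks, B ⊆ q.zero ∨
    ∃ C ∈ q.blocks, B ⊆ C ∧ ∃ g : ZMod r, ∀ a ∈ B, q.label a = p.label a + g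

theorem Refines.trans {p q s : PrePartition n r} (h : p.Refines q) (h' : q.Refines s) :
    p.Refines s := by
  refine ⟨h.1.trans h'.1, fun B hB => ?_⟩
  rcases h.2 B hB with h1 | ⟨C, hC, hBC, g, hg⟩
  · exact Or.inl (h1.trans h'.1)
  · rcases h'.2 C hC with h1 | ⟨D, hD, hCD, g', hg'⟩
    · exact Or.inl (hBC.trans h1)
    · exact Or.inr ⟨D, hD, hBC.trans hCD, g + g', fun a ha => by
        rw [hg' a (hBC ha), hg a ha, add_assoc]⟩

theorem Equivalent.symm {p q : PrePartition n r} (h : p.Equivalent q) : q.Equivalent p :=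
  (PrePartition.setoid n r).iseqv.symm h

theorem Equivalent.refines {p q : PrePartition n r} (h : p.Equivalent q) : p.Refines q :=
  ⟨h.1.subset, fun B hB => Or.inr ⟨B, h.2.1 ▸ hB, subset_rfl, h.2.2 B hB⟩⟩

/-- The prepartition obtained by merging `B` into the zero block is the least one above `p` whose
zero block contains `B`. -/
theorem refines_iff_of_mergeZero {p p' q : PrePartition n r} {B : Finset (Fin n)}
    (hz : p'.zero = p.zero ∪ B) (hb : p'.blocks = p.blocks.erase B)
    (hl : ∀ a, a ∉ p'.zero → p'.label a = p.label a) :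
    p'.Refines q ↔ p.Refines q ∧ B ⊆ q.zero := by
  have hl' : ∀ D ∈ p'.blocks, ∀ a ∈ D, p'.label a = p.label a := fun D hD a ha =>
    hl a (notMem_zero_of_mem hD ha)
  constructor
  · rintro ⟨h1, h2⟩
    rw [hz, Finset.union_subset_iff] at h1
    refine ⟨⟨h1.1, fun D hD => ?_⟩, h1.2⟩
    by_cases hDB : D = B
    · exact Or.inl (hDB ▸ h1.2)
    · have hD' : D ∈ p'.blocks := hb ▸ Finset.mem_erase.2 ⟨hDB, hD⟩
      rcases h2 D hD' with h | ⟨C, hC, hDC, g, hg⟩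
      · exact Or.inl h
      · exact Or.inr ⟨C, hC, hDC, g, fun a ha => by rw [hg a ha, hl' D hD' a ha]⟩
  · rintro ⟨⟨h1, h2⟩, h3⟩
    refine ⟨hz ▸ Finset.union_subset h1 h3, fun D hD => ?_⟩
    rcases h2 D (Finset.mem_of_mem_erase (hb ▸ hD)) with h | ⟨C, hC, hDC, g, hg⟩
    · exact Or.inl h
    · exact Or.inr ⟨C, hC, hDC, g, fun a ha => by rw [hg a ha, hl' D hD a ha]⟩

/-- The prepartition obtained by merging `B` with the translate by `g` of `C` is the least one above
`p` in which the two blocks are merged in this way or contained in the zero block. -/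
theorem refines_iff_of_mergeNonzero {p p' q : PrePartition n r} {B C : Finset (Fin n)} {g : ZMod r}
    (hB : B ∈ p.blocks) (hC : C ∈ p.blocks) (hBC : B ≠ C) (hz : p'.zero = p.zero)
    (hb : p'.blocks = insert (B ∪ C) ((p.blocks.erase B).erase C))
    (hlC : ∀ a ∈ C, p'.label a = p.label a + g)
    (hl : ∀ a, a ∉ p'.zero → a ∉ C → p'.label a = p.label a) :
    p'.Refines q ↔ p.Refines q ∧ (B ∪ C ⊆ q.zero ∨ ∃ D ∈ q.blocks, B ∪ C ⊆ D ∧ ∃ h : ZMod r,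
      (∀ a ∈ B, q.label a = p.label a + h) ∧ ∀ a ∈ C, q.label a = p.label a + g + h) := by
  have hlD : ∀ D ∈ p.blocks, D ≠ C → ∀ a ∈ D, p'.label a = p.label a := fun D hD hDC a ha =>
    hl a (hz ▸ notMem_zero_of_mem hD ha) fun haC => hDC (eq_of_mem_blocks hD hC ha haC)
  constructor
  · rintro ⟨h1, h2⟩
    rw [hz] at h1
    have h3 : B ∪ C ⊆ q.zero ∨ ∃ D ∈ q.blocks, B ∪ C ⊆ D ∧ ∃ h : ZMod r,
        (∀ a ∈ B, q.label a = p.label a + h) ∧ ∀ a ∈ C, q.label a = p.label a + g + h := by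
      rcases h2 (B ∪ C) (hb ▸ Finset.mem_insert_self _ _) with h | ⟨D, hD, hs, k, hk⟩
      · exact Or.inl h
      · refine Or.inr ⟨D, hD, hs, k, fun a ha => ?_, fun a ha => ?_⟩
        · rw [hk a (Finset.mem_union_left _ ha), hlD B hB hBC a ha]
        · rw [hk a (Finset.mem_union_right _ ha), hlC a ha]
    refine ⟨⟨h1, fun D hD => ?_⟩, h3⟩
    by_cases hDB : D = B
    · subst hDB
      rcases h3 with h | ⟨E, hE, hs, k, hk, -⟩
      · exact Or.inl (Finset.union_subset_left h)
      · exact Or.inr ⟨E, hE, Finset.union_subset_left hs, k, hk⟩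
    by_cases hDC : D = C
    · subst hDC
      rcases h3 with h | ⟨E, hE, hs, k, -, hk⟩
      · exact Or.inl (Finset.union_subset_right h)
      · exact Or.inr ⟨E, hE, Finset.union_subset_right hs, g + k, fun a ha => by
          rw [hk a ha, add_assoc]⟩
    rcases h2 D (hb ▸ Finset.mem_insert_of_mem (Finset.mem_erase.2
      ⟨hDC, Finset.mem_erase.2 ⟨hDB, hD⟩⟩)) with h | ⟨E, hE, hs, k, hk⟩
    · exact Or.inl h
    · exact Or.inr ⟨E, hE, hs, k, fun a ha => by rw [hk a ha, hlD D hD hDC a ha]⟩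
  · rintro ⟨⟨h1, h2⟩, h3⟩
    refine ⟨hz ▸ h1, fun D hD => ?_⟩
    rw [hb, Finset.mem_insert] at hD
    rcases hD with rfl | hD
    · refine h3.imp id ?_
      rintro ⟨D, hD, hs, k, hkB, hkC⟩
      refine ⟨D, hD, hs, k, fun a ha => ?_⟩
      by_cases haC : a ∈ C
      · rw [hkC a haC, hlC a haC]
      · have haB := (Finset.mem_union.1 ha).resolve_right haC
        rw [hkB a haB, hlD B hB hBC a haB]
    · have hD1 := (Finset.mem_erase.1 hD).1
      have hD2 := Finset.mem_of_mem_erase (Finset.mem_of_mem_erase hD)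
      rcases h2 D hD2 with h | ⟨E, hE, hs, k, hk⟩
      · exact Or.inl h
      · exact Or.inr ⟨E, hE, hs, k, fun a ha => by rw [hk a ha, hlD D hD2 hD1 a ha]⟩

theorem refines_refl (p : PrePartition n r) : p.Refines p :=
  Equivalent.refines ((PrePartition.setoid n r).refl p)

/-- Every nonzero block can be merged into the zero block. -/
theorem exists_mergeZero (p : PrePartition n r) {B : Finset (Fin n)} (hB : B ∈ p.blocks) :
    ∃ q : PrePartition n r, q.zero = p.zero ∪ B ∧ q.blocks = p.blocks.erase B ∧
      q.label = p.label := by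
  refine ⟨ofBlocks (p.blocks.erase B)
    (fun D hD => nonempty_of_mem_blocks (Finset.mem_of_mem_erase hD))
    (fun D hD E hE a => eq_of_mem_blocks (Finset.mem_of_mem_erase hD)
      (Finset.mem_of_mem_erase hE)) p.label, ?_, rfl, rfl⟩
  ext a
  simp only [ofBlocks, Finset.mem_filter, Finset.mem_univ, true_and, Finset.mem_union,
    Finset.mem_erase]
  constructor
  · intro h
    by_contra hno
    push Not at hno
    obtain ⟨D, hD, ha⟩ := exists_mem_blocks hno.1
    exact h D ⟨fun h => hno.2 (h ▸ ha), hD⟩ ha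
  · rintro (h | h) D ⟨hDB, hD⟩ ha
    · exact notMem_zero_of_mem hD ha h
    · exact hDB (eq_of_mem_blocks hD hB ha h)

/-- Any two nonzero blocks can be merged, after any translation of the second one. -/
theorem exists_mergeNonzero (p : PrePartition n r) {B C : Finset (Fin n)} (hB : B ∈ p.blocks)
    (hC : C ∈ p.blocks) (g : ZMod r) :
    ∃ q : PrePartition n r, q.zero = p.zero ∧
      q.blocks = insert (B ∪ C) ((p.blocks.erase B).erase C) ∧
      q.label = fun a => if a ∈ C then p.label a + g else p.label a := by
  have hmem : ∀ D ∈ insert (B ∪ C) ((p.blocks.erase B).erase C),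
      D = B ∪ C ∨ D ∈ p.blocks ∧ D ≠ B ∧ D ≠ C := fun D hD => by
    simp only [Finset.mem_insert, Finset.mem_erase] at hD
    tauto
  have hdis : ∀ D ∈ p.blocks, D ≠ B → D ≠ C → ∀ a ∈ D, a ∉ B ∪ C := fun D hD h1 h2 a ha h => by
    rcases Finset.mem_union.1 h with h | h
    · exact h1 (eq_of_mem_blocks hD hB ha h)
    · exact h2 (eq_of_mem_blocks hD hC ha h)
  refine ⟨ofBlocks (insert (B ∪ C) ((p.blocks.erase B).erase C)) (fun D hD => ?_)
    (fun D hD E hE a haD haE => ?_) _, ?_, rfl, rfl⟩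
  · rcases hmem D hD with rfl | h
    · exact (nonempty_of_mem_blocks hB).mono Finset.subset_union_left
    · exact nonempty_of_mem_blocks h.1
  · rcases hmem D hD with rfl | ⟨h1, h2, h3⟩
    · rcases hmem E hE with rfl | ⟨h1, h2, h3⟩
      · rfl
      · exact absurd haD (hdis E h1 h2 h3 a haE)
    · rcases hmem E hE with rfl | ⟨h1', -, -⟩
      · exact absurd haE (hdis D h1 h2 h3 a haD)
      · exact eq_of_mem_blocks h1 h1' haD haE
  · ext a
    simp only [ofBlocks, Finset.mem_filter, Finset.mem_univ, true_and]
    constructor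
    · intro h
      by_contra hno
      obtain ⟨D, hD, ha⟩ := exists_mem_blocks hno
      have hBC : a ∉ B ∪ C := h _ (Finset.mem_insert_self _ _)
      rw [Finset.mem_union, not_or] at hBC
      exact h D (Finset.mem_insert_of_mem (Finset.mem_erase.2 ⟨fun h => hBC.2 (h ▸ ha),
        Finset.mem_erase.2 ⟨fun h => hBC.1 (h ▸ ha), hD⟩⟩)) ha
    · intro h D hD ha
      rcases hmem D hD with rfl | h'
      · rcases Finset.mem_union.1 ha with ha | ha
        · exact notMem_zero_of_mem hB ha h
        · exact notMem_zero_of_mem hC ha h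
      · exact notMem_zero_of_mem h'.1 ha h

end PrePartition

namespace DowlingLattice

open PrePartition

variable {n r : ℕ}

theorem exists_mk (x : DowlingLattice n r) : ∃ p, mk p = x := Quotient.exists_rep x

theorem mk_eq_mk {p q : PrePartition n r} : mk p = mk q ↔ p.Equivalent q := Quotient.eq

instance [NeZero r] : Finite (DowlingLattice n r) := by
  have : Finite (PrePartition n r) := by
    refine Finite.of_injective (fun p => (p.zero, p.blocks, p.label)) ?_
    rintro ⟨z, ⟨P, h1, h2, h3⟩, l⟩ ⟨z', ⟨P', h1', h2', h3'⟩, l'⟩ h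
    obtain ⟨rfl, hP, rfl⟩ : z = z' ∧ P = P' ∧ l = l' := by simpa [blocks] using h
    subst hP
    rfl
  exact Quotient.finite _

theorem refines_of_merge {p q : PrePartition n r} (h : Merge (mk p) (mk q)) : p.Refines q := by
  obtain ⟨p', q', hp, hq, h⟩ := h
  refine (mk_eq_mk.1 hp.symm).refines.trans (Refines.trans ?_ (mk_eq_mk.1 hq).refines)
  rcases h with ⟨B, hB, hz, hb, hl⟩ | ⟨B, hB, C, hC, hBC, g, hz, hb, hlC, hl⟩
  · exact ((refines_iff_of_mergeZero hz hb hl).1 (refines_refl q')).1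
  · exact ((refines_iff_of_mergeNonzero hB hC hBC hz hb hlC hl).1 (refines_refl q')).1

/-- The order generated by the merges is refinement. -/
theorem mk_le_mk {p q : PrePartition n r} : mk p ≤ mk q ↔ p.Refines q := by
  constructor
  · intro h
    have key : ∀ x : DowlingLattice n r, Relation.ReflTransGen Merge (mk p) x →
        ∀ s, mk s = x → p.Refines s := fun x hx => by
      induction hx with
      | refl => exact fun s hs => (mk_eq_mk.1 hs.symm).refines
      | @tail y z _ hyz ih =>
        rintro s rfl
        obtain ⟨u, rfl⟩ := exists_mk y
        exact (ih u rfl).trans (refines_of_merge hyz)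
    exact key _ h q rfl
  · intro h
    induction hm : p.blocks.card using Nat.strong_induction_on generalizing p with
    | _ m ih =>
    by_cases hzero : q.zero ⊆ p.zero
    swap
    · obtain ⟨a, haq, hap⟩ := Finset.not_subset.1 hzero
      obtain ⟨B, hB, ha⟩ := exists_mem_blocks hap
      have hBq : B ⊆ q.zero := (h.2 B hB).resolve_right fun ⟨C, hC, hBC, _⟩ =>
        notMem_zero_of_mem hC (hBC ha) haq
      obtain ⟨p', hz, hb, hl⟩ := exists_mergeZero p hB
      have hM : Merge (mk p) (mk p') := ⟨p, p', rfl, rfl, Or.inl ⟨B, hB, hz, hb, by simp [hl]⟩⟩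
      exact Relation.ReflTransGen.head hM (ih p'.blocks.card
        (by rw [hb, ← hm]; exact Finset.card_erase_lt_of_mem hB)
        ((refines_iff_of_mergeZero hz hb (by simp [hl])).2 ⟨h, hBq⟩) rfl)
    have hz : p.zero = q.zero := h.1.antisymm hzero
    have hcontained : ∀ B ∈ p.blocks, ∃ C ∈ q.blocks, B ⊆ C ∧
        ∃ g : ZMod r, ∀ a ∈ B, q.label a = p.label a + g := fun B hB =>
      (h.2 B hB).resolve_left fun hs => by
        obtain ⟨a, ha⟩ := nonempty_of_mem_blocks hB
        exact notMem_zero_of_mem hB ha (hz ▸ hs ha)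
    by_cases hproper : ∃ B ∈ p.blocks, ∃ C ∈ q.blocks, B ⊆ C ∧ B ≠ C
    · obtain ⟨B, hB, D, hD, hBD, hne⟩ := hproper
      obtain ⟨c, hcD, hcB⟩ := Finset.exists_of_ssubset (hBD.ssubset_of_ne hne)
      obtain ⟨C, hC, hc⟩ := exists_mem_blocks (hz ▸ notMem_zero_of_mem hD hcD : c ∉ p.zero)
      obtain ⟨D1, hD1, hBD1, g1, hg1⟩ := hcontained B hB
      obtain ⟨D2, hD2, hCD2, g2, hg2⟩ := hcontained C hC
      obtain ⟨b, hb⟩ := nonempty_of_mem_blocks hB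
      obtain rfl : D1 = D := eq_of_mem_blocks hD1 hD (hBD1 hb) (hBD hb)
      obtain rfl : D2 = D1 := eq_of_mem_blocks hD2 hD (hCD2 hc) hcD
      have hBC : B ≠ C := fun h => hcB (h ▸ hc)
      obtain ⟨p', hz', hb', hl'⟩ := exists_mergeNonzero p hB hC (g2 - g1)
      have hlC : ∀ a ∈ C, p'.label a = p.label a + (g2 - g1) := fun a ha => by simp [hl', ha]
      have hl : ∀ a, a ∉ p'.zero → a ∉ C → p'.label a = p.label a := fun a _ ha => by
        simp [hl', ha]
      have hM : Merge (mk p) (mk p') :=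
        ⟨p, p', rfl, rfl, Or.inr ⟨B, hB, C, hC, hBC, g2 - g1, hz', hb', hlC, hl⟩⟩
      have hcard : p.blocks.card = p'.blocks.card + 1 := hM.numBlocks_eq
      refine Relation.ReflTransGen.head hM (ih p'.blocks.card (by omega)
        ((refines_iff_of_mergeNonzero hB hC hBC hz' hb' hlC hl).2 ⟨h, Or.inr
          ⟨D2, hD2, Finset.union_subset hBD hCD2, g1, hg1, fun a ha => ?_⟩⟩) rfl)
      rw [hg2 a ha]
      abel
    · push Not at hproper
      refine (mk_eq_mk.2 ⟨hz, ?_, fun B hB => ?_⟩).le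
      · ext B
        constructor
        · intro hB
          obtain ⟨C, hC, hBC, -⟩ := hcontained B hB
          exact hproper B hB C hC hBC ▸ hC
        · intro hB
          obtain ⟨a, ha⟩ := nonempty_of_mem_blocks hB
          obtain ⟨C, hC, haC⟩ := exists_mem_blocks (hz ▸ notMem_zero_of_mem hB ha : a ∉ p.zero)
          obtain ⟨D, hD, hCD, -⟩ := hcontained C hC
          obtain rfl : D = B := eq_of_mem_blocks hD hB (hCD haC) ha
          exact hproper C hC D hD hCD ▸ hC
      · obtain ⟨C, hC, hBC, hg⟩ := hcontained B hB
        exact hg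

theorem Merge.le {x y : DowlingLattice n r} (h : Merge x y) : x ≤ y :=
  Relation.ReflTransGen.single h

theorem numBlocks_anti {x y : DowlingLattice n r} (h : x ≤ y) : y.numBlocks ≤ x.numBlocks :=
  numBlocks_le_of_reflTransGen h

theorem exists_merge_le_of_lt {x y : DowlingLattice n r} (h : x < y) : ∃ z, Merge x z ∧ z ≤ y := by
  rcases Relation.ReflTransGen.cases_head (show Relation.ReflTransGen Merge x y from h.le) with
    rfl | ⟨z, hz, hzy⟩
  · exact absurd h (lt_irrefl _)
  · exact ⟨z, hz, hzy⟩

theorem numBlocks_strictAnti {x y : DowlingLattice n r} (h : x < y) :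
    y.numBlocks < x.numBlocks := by
  obtain ⟨z, hz, hzy⟩ := exists_merge_le_of_lt h
  have := hz.numBlocks_eq
  have := numBlocks_anti hzy
  omega

/-! ### Joins and semimodularity -/

/-- An element `m` is small if joining it to any element amounts to at most one merge. (The small
elements are the atoms and the minimum.) -/
def IsSmall (m : DowlingLattice n r) : Prop :=
  ∀ x, ∃ w, (w = x ∨ Merge x w) ∧ IsLUB {x, m} w

/-- Requiring `b` to lie in the zero block costs at most one merge. -/
theorem exists_least_mem_zero (p : PrePartition n r) (b : Fin n) :
    ∃ w, (w = mk p ∨ Merge (mk p) w) ∧ ∀ q, w ≤ mk q ↔ mk p ≤ mk q ∧ b ∈ q.zero := by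
  by_cases hb : b ∈ p.zero
  · exact ⟨mk p, Or.inl rfl, fun q => ⟨fun h => ⟨h, (mk_le_mk.1 h).1 hb⟩, And.left⟩⟩
  · obtain ⟨B, hB, hbB⟩ := exists_mem_blocks hb
    obtain ⟨p', hz, hb', hl⟩ := exists_mergeZero p hB
    refine ⟨mk p', Or.inr ⟨p, p', rfl, rfl, Or.inl ⟨B, hB, hz, hb', by simp [hl]⟩⟩, fun q => ?_⟩
    rw [mk_le_mk, mk_le_mk, refines_iff_of_mergeZero hz hb' (by simp [hl])]
    refine and_congr_right fun h => ⟨fun hs => hs hbB, fun hbq => ?_⟩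
    exact (h.2 B hB).resolve_right fun ⟨C, hC, hBC, _⟩ => notMem_zero_of_mem hC (hBC hbB) hbq

/-- The elements `b` and `c` both lie in the zero block, or they lie in the same nonzero block and
their labels differ by `δ`. -/
def _root_.PrePartition.Linked (q : PrePartition n r) (b c : Fin n) (δ : ZMod r) : Prop :=
  (b ∈ q.zero ∧ c ∈ q.zero) ∨ ∃ D ∈ q.blocks, b ∈ D ∧ c ∈ D ∧ q.label c = q.label b + δ

theorem _root_.PrePartition.Refines.linked {p q : PrePartition n r} (h : p.Refines q) {b c : Fin n}
    {δ : ZMod r} (hp : p.Linked b c δ) : q.Linked b c δ := by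
  rcases hp with hp | ⟨D, hD, hb, hc, hl⟩
  · exact Or.inl ⟨h.1 hp.1, h.1 hp.2⟩
  · rcases h.2 D hD with hs | ⟨E, hE, hs, g, hg⟩
    · exact Or.inl ⟨hs hb, hs hc⟩
    · exact Or.inr ⟨E, hE, hs hb, hs hc, by rw [hg c hc, hg b hb, hl]; abel⟩

/-- Linking two elements costs at most one merge. -/
theorem exists_least_linked (p : PrePartition n r) (b c : Fin n) (δ : ZMod r) :
    ∃ w, (w = mk p ∨ Merge (mk p) w) ∧ ∀ q, w ≤ mk q ↔ mk p ≤ mk q ∧ q.Linked b c δ := by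
  by_cases hp : p.Linked b c δ
  · exact ⟨mk p, Or.inl rfl, fun q => ⟨fun h => ⟨h, (mk_le_mk.1 h).linked hp⟩, And.left⟩⟩
  -- Unless `b` and `c` lie in distinct nonzero blocks, both are forced into the zero block.
  have key : ∀ a : Fin n, (∀ q : PrePartition n r, p.Refines q → (a ∈ q.zero ↔ q.Linked b c δ)) →
      ∃ w, (w = mk p ∨ Merge (mk p) w) ∧ ∀ q, w ≤ mk q ↔ mk p ≤ mk q ∧ q.Linked b c δ := by
    intro a ha
    obtain ⟨w, hw, h⟩ := exists_least_mem_zero p a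
    exact ⟨w, hw, fun q => (h q).trans (and_congr_right fun hq => ha q (mk_le_mk.1 hq))⟩
  by_cases hb : b ∈ p.zero
  · refine key c fun q hq => ⟨fun h => Or.inl ⟨hq.1 hb, h⟩, ?_⟩
    rintro (h | ⟨D, hD, hbD, -⟩)
    · exact h.2
    · exact absurd (hq.1 hb) (notMem_zero_of_mem hD hbD)
  by_cases hc : c ∈ p.zero
  · refine key b fun q hq => ⟨fun h => Or.inl ⟨h, hq.1 hc⟩, ?_⟩
    rintro (h | ⟨D, hD, -, hcD, -⟩)
    · exact h.1
    · exact absurd (hq.1 hc) (notMem_zero_of_mem hD hcD)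
  obtain ⟨B, hB, hbB⟩ := exists_mem_blocks hb
  obtain ⟨C, hC, hcC⟩ := exists_mem_blocks hc
  by_cases hBC : B = C
  · subst hBC
    refine key b fun q hq => ?_
    rcases hq.2 B hB with hs | ⟨E, hE, hs, g, hg⟩
    · exact ⟨fun _ => Or.inl ⟨hs hbB, hs hcC⟩, fun _ => hs hbB⟩
    · refine ⟨fun h => absurd h (notMem_zero_of_mem hE (hs hbB)), ?_⟩
      rintro (h | ⟨D, hD, -, -, hl⟩)
      · exact h.1
      · refine absurd (Or.inr ⟨B, hB, hbB, hcC, ?_⟩) hp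
        rw [hg c hcC, hg b hbB] at hl
        exact add_right_cancel (b := g) (by rw [hl]; abel)
  · obtain ⟨p', hz', hb', hl'⟩ := exists_mergeNonzero p hB hC (p.label b + δ - p.label c)
    have hlC : ∀ a ∈ C, p'.label a = p.label a + (p.label b + δ - p.label c) := fun a ha => by
      simp [hl', ha]
    have hl : ∀ a, a ∉ p'.zero → a ∉ C → p'.label a = p.label a := fun a _ ha => by
      simp [hl', ha]
    refine ⟨mk p', Or.inr ⟨p, p', rfl, rfl, Or.inr ⟨B, hB, C, hC, hBC, _, hz', hb', hlC, hl⟩⟩,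
      fun q => ?_⟩
    rw [mk_le_mk, mk_le_mk, refines_iff_of_mergeNonzero hB hC hBC hz' hb' hlC hl]
    refine and_congr_right fun hq => ⟨?_, ?_⟩
    · rintro (hs | ⟨D, hD, hs, k, hkB, hkC⟩)
      · exact Or.inl ⟨hs (Finset.mem_union_left _ hbB), hs (Finset.mem_union_right _ hcC)⟩
      · refine Or.inr ⟨D, hD, hs (Finset.mem_union_left _ hbB),
          hs (Finset.mem_union_right _ hcC), ?_⟩
        rw [hkB b hbB, hkC c hcC]
        abel
    · rintro (⟨h1, h2⟩ | ⟨D, hD, h1, h2, h3⟩)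
      · refine Or.inl (Finset.union_subset ?_ ?_)
        · exact (hq.2 B hB).resolve_right fun ⟨E, hE, hs, _⟩ =>
            notMem_zero_of_mem hE (hs hbB) h1
        · exact (hq.2 C hC).resolve_right fun ⟨E, hE, hs, _⟩ =>
            notMem_zero_of_mem hE (hs hcC) h2
      · obtain ⟨E, hE, hs, g, hg⟩ := (hq.2 B hB).resolve_left fun hs =>
          notMem_zero_of_mem hD h1 (hs hbB)
        obtain ⟨E', hE', hs', g', hg'⟩ := (hq.2 C hC).resolve_left fun hs =>
          notMem_zero_of_mem hD h2 (hs hcC)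
        obtain rfl : E = D := eq_of_mem_blocks hE hD (hs hbB) h1
        obtain rfl : E' = E := eq_of_mem_blocks hE' hE (hs' hcC) h2
        refine Or.inr ⟨E', hE, Finset.union_subset hs hs', g, hg, fun a ha => ?_⟩
        rw [hg b hbB, hg' c hcC] at h3
        have hgg : g' = p.label b + δ - p.label c + g := by
          rw [eq_sub_of_add_eq' h3]
          abel
        rw [hg' a ha, hgg]
        abel

theorem exists_isSmall_of_forall {G : PrePartition n r → Prop}
    (hG : ∀ p, ∃ w, (w = mk p ∨ Merge (mk p) w) ∧ ∀ q, w ≤ mk q ↔ mk p ≤ mk q ∧ G q) :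
    ∃ m, IsSmall m ∧ ∀ q, m ≤ mk q ↔ G q := by
  obtain ⟨m, -, hm⟩ := hG (PrePartition.finest n r)
  have hm' : ∀ q, m ≤ mk q ↔ G q := fun q => (hm q).trans (and_iff_right bot_le)
  refine ⟨m, fun x => ?_, hm'⟩
  obtain ⟨p, rfl⟩ := exists_mk x
  obtain ⟨w, hw, h⟩ := hG p
  refine ⟨w, hw, isLUB_pair_iff.2 fun y => ?_⟩
  obtain ⟨q, rfl⟩ := exists_mk y
  rw [h, hm']

/-- Every merge is the join with a small element. -/
theorem Merge.exists_isSmall {x y : DowlingLattice n r} (h : Merge x y) :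
    ∃ m, IsSmall m ∧ IsLUB {x, m} y := by
  obtain ⟨p, p', rfl, rfl, ⟨B, hB, hz, hb, hl⟩ | ⟨B, hB, C, hC, hBC, g, hz, hb, hlC, hl⟩⟩ := h
  · obtain ⟨b, hbB⟩ := nonempty_of_mem_blocks hB
    obtain ⟨m, hm, hG⟩ := exists_isSmall_of_forall fun p => exists_least_mem_zero p b
    refine ⟨m, hm, isLUB_pair_iff.2 fun y => ?_⟩
    obtain ⟨q, rfl⟩ := exists_mk y
    rw [hG, mk_le_mk, mk_le_mk, refines_iff_of_mergeZero hz hb hl]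
    refine and_congr_right fun hq => ⟨fun hs => hs hbB, fun hbq => ?_⟩
    exact (hq.2 B hB).resolve_right fun ⟨C, hC, hBC, _⟩ => notMem_zero_of_mem hC (hBC hbB) hbq
  · obtain ⟨b, hbB⟩ := nonempty_of_mem_blocks hB
    obtain ⟨c, hcC⟩ := nonempty_of_mem_blocks hC
    obtain ⟨m, hm, hG⟩ := exists_isSmall_of_forall fun p =>
      exists_least_linked p b c (p'.label c - p'.label b)
    refine ⟨m, hm, isLUB_pair_iff.2 fun y => ?_⟩
    obtain ⟨q, rfl⟩ := exists_mk y
    have hBC' : B ∪ C ∈ p'.blocks := hb ▸ Finset.mem_insert_self _ _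
    have hbp : p'.label b = p.label b := hl b (hz ▸ notMem_zero_of_mem hB hbB)
      fun h => hBC (eq_of_mem_blocks hB hC hbB h)
    rw [hG, mk_le_mk, mk_le_mk]
    constructor
    · intro h
      refine ⟨((refines_iff_of_mergeNonzero hB hC hBC hz hb hlC hl).1 h).1, h.linked (Or.inr
        ⟨_, hBC', Finset.mem_union_left _ hbB, Finset.mem_union_right _ hcC, by abel⟩)⟩
    · rintro ⟨hq, hlink⟩
      rw [refines_iff_of_mergeNonzero hB hC hBC hz hb hlC hl]
      refine ⟨hq, ?_⟩
      rcases hlink with ⟨h1, h2⟩ | ⟨D, hD, h1, h2, h3⟩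
      · refine Or.inl (Finset.union_subset ?_ ?_)
        · exact (hq.2 B hB).resolve_right fun ⟨E, hE, hs, _⟩ =>
            notMem_zero_of_mem hE (hs hbB) h1
        · exact (hq.2 C hC).resolve_right fun ⟨E, hE, hs, _⟩ =>
            notMem_zero_of_mem hE (hs hcC) h2
      · obtain ⟨E, hE, hs, k, hk⟩ := (hq.2 B hB).resolve_left fun hs =>
          notMem_zero_of_mem hD h1 (hs hbB)
        obtain ⟨E', hE', hs', k', hk'⟩ := (hq.2 C hC).resolve_left fun hs =>
          notMem_zero_of_mem hD h2 (hs hcC)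
        obtain rfl : E = D := eq_of_mem_blocks hE hD (hs hbB) h1
        obtain rfl : E' = E := eq_of_mem_blocks hE' hE (hs' hcC) h2
        refine Or.inr ⟨E', hE, Finset.union_subset hs hs', k, hk, fun a ha => ?_⟩
        rw [hk b hbB, hk' c hcC, hlC c hcC, hbp] at h3
        have hkk : k' = g + k := add_left_cancel (a := p.label c) (by rw [h3]; abel)
        rw [hk' a ha, hkk, add_assoc]

theorem exists_isLUB (x y : DowlingLattice n r) : ∃ z, IsLUB {x, y} z := by
  have key : ∀ y : DowlingLattice n r, Relation.ReflTransGen Merge ⊥ y → ∃ z, IsLUB {x, y} z := by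
    intro y hy
    induction hy with
    | refl => exact ⟨x, isLUB_pair_iff.2 fun t => by simp⟩
    | @tail u v _ huv ih =>
      obtain ⟨z, hz⟩ := ih
      obtain ⟨m, hm, hv⟩ := huv.exists_isSmall
      obtain ⟨w, -, hw⟩ := hm z
      refine ⟨w, isLUB_pair_iff.2 fun t => ?_⟩
      rw [isLUB_pair_iff.1 hw, isLUB_pair_iff.1 hz, isLUB_pair_iff.1 hv, and_assoc]
  exact key y (bot_le : ⊥ ≤ y)

/-- The Dowling lattice is semimodular. -/
theorem exists_merge_of_merge {x a b y : DowlingLattice n r} (ha : Merge x a) (hb : Merge x b)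
    (hab : a ≠ b) (hay : a ≤ y) (hby : b ≤ y) : ∃ z, Merge a z ∧ b ≤ z ∧ z ≤ y := by
  obtain ⟨m, hm, hxm⟩ := hb.exists_isSmall
  obtain ⟨z, hz, hlub⟩ := hm a
  have hbz : b ≤ z := (isLUB_pair_iff.1 hxm z).2 ⟨ha.le.trans (hlub.1 (by simp)), hlub.1 (by simp)⟩
  refine ⟨z, hz.resolve_left ?_, hbz,
    (isLUB_pair_iff.1 hlub y).2 ⟨hay, ((isLUB_pair_iff.1 hxm y).1 hby).2⟩⟩
  rintro rfl
  have h1 := numBlocks_strictAnti (lt_of_le_of_ne hbz hab.symm)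
  have h2 := ha.numBlocks_eq
  have h3 := hb.numBlocks_eq
  omega

end DowlingLattice

/-! ### Evenly coloured blocks -/

section EvenlyColoured

variable {n r d k : ℕ}

/-- With respect to the colouring `φ ∘ γ`, every colour occurs equally often in `B`. -/
def EvenlyColoured (φ : ZMod r →+* ZMod k) (B : Finset (Fin n)) (γ : Fin n → ZMod r) : Prop :=
  ∀ u v : ZMod k, (B.filter fun a => φ (γ a) = u).card = (B.filter fun a => φ (γ a) = v).card

variable {φ : ZMod r →+* ZMod k} {B C : Finset (Fin n)} {γ γ' : Fin n → ZMod r}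

theorem EvenlyColoured.translate (h : EvenlyColoured φ B γ) {g : ZMod r}
    (hg : ∀ a ∈ B, γ' a = γ a + g) :
    EvenlyColoured φ B γ' := by
  have key : ∀ u, (B.filter fun a => φ (γ' a) = u) = B.filter fun a => φ (γ a) = u - φ g :=
    fun u => Finset.filter_congr fun a ha => by rw [hg a ha, map_add, eq_sub_iff_add_eq]
  intro u v
  rw [key, key]
  exact h _ _

theorem EvenlyColoured.union (hB : EvenlyColoured φ B γ) (hC : EvenlyColoured φ C γ)
    (hd : Disjoint B C) :
    EvenlyColoured φ (B ∪ C) γ := by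
  intro u v
  rw [Finset.filter_union, Finset.filter_union,
    Finset.card_union_of_disjoint (Finset.disjoint_filter_filter hd),
    Finset.card_union_of_disjoint (Finset.disjoint_filter_filter hd), hB u v, hC u v]

theorem EvenlyColoured.sdiff (hB : EvenlyColoured φ B γ) (hC : EvenlyColoured φ C γ) (hs : C ⊆ B) :
    EvenlyColoured φ (B \ C) γ := by
  have key : ∀ u, ((B \ C).filter fun a => φ (γ a) = u).card +
      (C.filter fun a => φ (γ a) = u).card = (B.filter fun a => φ (γ a) = u).card := fun u => by
    rw [← Finset.card_union_of_disjoint (Finset.disjoint_filter_filter Finset.sdiff_disjoint),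
      ← Finset.filter_union, Finset.sdiff_union_of_subset hs]
  intro u v
  have h1 := key u
  have h2 := key v
  have h3 := hB u v
  have h4 := hC u v
  omega

theorem EvenlyColoured.image (hB : EvenlyColoured φ B γ) {σ : Fin n → Fin n}
    (hσ : Function.Injective σ)
    (h : ∀ a ∈ B, φ (γ' (σ a)) = φ (γ a)) : EvenlyColoured φ (B.image σ) γ' := by
  have key : ∀ u, ((B.image σ).filter fun a => φ (γ' a) = u).card =
      (B.filter fun a => φ (γ a) = u).card := fun u => by
    rw [Finset.filter_image, Finset.card_image_of_injective _ hσ]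
    exact congrArg Finset.card (Finset.filter_congr fun a ha => by rw [h a ha])
  intro u v
  rw [key, key]
  exact hB u v

variable [NeZero k]

theorem EvenlyColoured.mul_card_filter (hB : EvenlyColoured φ B γ) (u : ZMod k) :
    k * (B.filter fun a => φ (γ a) = u).card = B.card := by
  have h := Finset.card_eq_sum_card_fiberwise (s := B) (f := fun a => φ (γ a))
    (t := Finset.univ) (by simp)
  rw [h, Finset.sum_congr rfl fun v _ => hB v u]
  simp [ZMod.card]

/-- Every set whose size is a multiple of `k` has an evenly coloured labelling. -/
theorem exists_evenlyColoured (φ : ZMod r →+* ZMod k) (B : Finset (Fin n)) (hB : k ∣ B.card) :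
    ∃ γ : Fin n → ZMod r, EvenlyColoured φ B γ := by
  classical
  let e := B.equivFin
  refine ⟨fun a => if h : a ∈ B then ((e ⟨a, h⟩ : ℕ) : ZMod r) else 0, ?_⟩
  have key : ∀ u : ZMod k, (B.filter fun a =>
      φ (if h : a ∈ B then ((e ⟨a, h⟩ : ℕ) : ZMod r) else 0) = u).card = B.card / k := fun u => by
    have h1 := Nat.count_modEq_card B.card (Nat.pos_of_ne_zero (NeZero.ne k)) u.val
    rw [Nat.mod_eq_zero_of_dvd hB] at h1
    rw [← (by simpa using h1 : Nat.count (· ≡ u.val [MOD k]) B.card = B.card / k),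
      Nat.count_eq_card_filter_range]
    refine Finset.card_bij (fun a ha => (e ⟨a, (Finset.mem_filter.1 ha).1⟩ : ℕ)) ?_ ?_ ?_
    · intro a ha
      obtain ⟨haB, hu⟩ := Finset.mem_filter.1 ha
      rw [dif_pos haB, map_natCast] at hu
      simp only [Finset.mem_filter, Finset.mem_range, Fin.is_lt, true_and]
      rw [← ZMod.natCast_eq_natCast_iff, hu, ZMod.natCast_zmod_val]
    · intro a ha b hb h
      simpa using e.injective (Fin.ext h)
    · intro i hi
      simp only [Finset.mem_filter, Finset.mem_range] at hi
      rw [← ZMod.natCast_eq_natCast_iff, ZMod.natCast_zmod_val] at hi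
      have hm := (e.symm ⟨i, hi.1⟩).2
      refine ⟨e.symm ⟨i, hi.1⟩, Finset.mem_filter.2 ⟨hm, ?_⟩, by simp⟩
      rw [dif_pos hm, map_natCast]
      simpa using hi.2
  intro u v
  rw [key, key]

/-- An evenly coloured set contains evenly coloured subsets of every admissible size. -/
theorem EvenlyColoured.exists_subset (hB : EvenlyColoured φ B γ) (hkd : k ∣ d) (hd : d ≤ B.card) :
    ∃ C ⊆ B, C.card = d ∧ EvenlyColoured φ C γ := by
  classical
  obtain ⟨m, rfl⟩ := hkd
  have hk : 0 < k := Nat.pos_of_ne_zero (NeZero.ne k)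
  have hsub : ∀ u : ZMod k, ∃ D ⊆ B.filter fun a => φ (γ a) = u, D.card = m := fun u => by
    refine Finset.exists_subset_card_eq ?_
    have := hB.mul_card_filter u
    exact Nat.le_of_mul_le_mul_left (this ▸ hd) hk
  choose D hD hm using hsub
  have hcol : ∀ u, ∀ a ∈ D u, a ∈ B ∧ φ (γ a) = u := fun u a ha => Finset.mem_filter.1 (hD u ha)
  have hf : ∀ u, ((Finset.univ.biUnion D).filter fun a => φ (γ a) = u) = D u := fun u => by
    ext a
    simp only [Finset.mem_filter, Finset.mem_biUnion, Finset.mem_univ, true_and]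
    constructor
    · rintro ⟨⟨v, hv⟩, rfl⟩
      rwa [(hcol v a hv).2]
    · exact fun h => ⟨⟨u, h⟩, (hcol u a h).2⟩
  have hbal : EvenlyColoured φ (Finset.univ.biUnion D) γ := fun u v => by rw [hf, hf, hm, hm]
  refine ⟨Finset.univ.biUnion D, fun a ha => ?_, ?_, hbal⟩
  · obtain ⟨u, -, hu⟩ := Finset.mem_biUnion.1 ha
    exact (hcol u a hu).1
  · rw [← hbal.mul_card_filter 0, hf, hm]

end EvenlyColoured

namespace PrePartition

variable {n r d k : ℕ}

/-- The prepartition is `d`-divisible and evenly coloured, the colour of a label being its image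
under `φ`. -/
def IsAdmissible (d : ℕ) (φ : ZMod r →+* ZMod k) (p : PrePartition n r) : Prop :=
  ∀ B ∈ p.blocks, d ∣ B.card ∧ EvenlyColoured φ B p.label

theorem isAdmissible_castHom_iff [NeZero r] [NeZero k] (hkr : k ∣ r) (p : PrePartition n r) :
    p.IsAdmissible d (ZMod.castHom hkr (ZMod k)) ↔ p.IsDivisible d ∧ p.IsEvenlyColoured k := by
  have key : ∀ (B : Finset (Fin n)) (i : ℕ),
      (B.filter fun a => (p.label a).val ≡ i [MOD k]) =
        B.filter fun a => ZMod.castHom hkr (ZMod k) (p.label a) = i := fun B i =>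
    Finset.filter_congr fun a _ => by
      rw [← ZMod.natCast_eq_natCast_iff]
      conv_rhs => rw [← ZMod.natCast_zmod_val (p.label a), map_natCast]
  constructor
  · refine fun h => ⟨fun B hB => (h B hB).1, fun B hB i j => ?_⟩
    rw [key, key]
    exact (h B hB).2 _ _
  · refine fun h B hB => ⟨h.1 B hB, fun u v => ?_⟩
    have := h.2 B hB u.val v.val
    rwa [key, key, ZMod.natCast_zmod_val, ZMod.natCast_zmod_val] at this

variable {φ : ZMod r →+* ZMod k}

theorem IsAdmissible.of_equivalent {p q : PrePartition n r} (hp : p.IsAdmissible d φ)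
    (h : p.Equivalent q) : q.IsAdmissible d φ := fun B hB => by
  have hB' : B ∈ p.blocks := h.2.1 ▸ hB
  obtain ⟨g, hg⟩ := h.2.2 B hB'
  exact ⟨(hp B hB').1, (hp B hB').2.translate hg⟩

theorem sum_card_blocks (p : PrePartition n r) :
    ∑ B ∈ p.blocks, B.card + p.zero.card = n := by
  have h := p.part.sum_card_parts
  rw [Finset.card_compl, Fintype.card_fin] at h
  have h' := Finset.card_le_univ p.zero
  rw [Fintype.card_fin] at h'
  change ∑ B ∈ p.part.parts, B.card + p.zero.card = n
  omega

theorem IsAdmissible.le_card {p : PrePartition n r} (hp : p.IsAdmissible d φ)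
    {B : Finset (Fin n)} (hB : B ∈ p.blocks) : d ≤ B.card :=
  Nat.le_of_dvd (Finset.card_pos.2 (nonempty_of_mem_blocks hB)) (hp B hB).1

theorem IsAdmissible.card_mul_le {p : PrePartition n r} (hp : p.IsAdmissible d φ) :
    p.blocks.card * d ≤ n := by
  have h1 := p.sum_card_blocks
  have h2 : p.blocks.card • d ≤ ∑ B ∈ p.blocks, B.card :=
    Finset.card_nsmul_le_sum _ _ _ fun B hB => hp.le_card hB
  rw [smul_eq_mul] at h2
  omega

/-- If the number of blocks is as large as possible, all blocks have size `d`. -/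
theorem IsAdmissible.card_eq {p : PrePartition n r} (hp : p.IsAdmissible d φ)
    (hd : 1 ≤ d) (h : p.blocks.card = n / d) {B : Finset (Fin n)} (hB : B ∈ p.blocks) :
    B.card = d := by
  by_contra hne
  obtain ⟨m, hm⟩ := (hp B hB).1
  have hpos := Finset.card_pos.2 (nonempty_of_mem_blocks hB)
  have hm2 : 2 ≤ m := by
    rcases m with _ | _ | m
    · omega
    · exact absurd (by simpa using hm) hne
    · omega
  have h2d : d * 2 ≤ B.card := hm ▸ Nat.mul_le_mul_left d hm2
  have h1 := p.sum_card_blocks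
  rw [← Finset.add_sum_erase _ _ hB] at h1
  have h2 := Finset.card_nsmul_le_sum (p.blocks.erase B) Finset.card d fun C hC =>
    hp.le_card (Finset.mem_of_mem_erase hC)
  rw [smul_eq_mul] at h2
  have h3 := Finset.card_erase_add_one hB
  have h4 : n < (n / d + 1) * d := Nat.lt_mul_of_div_lt (Nat.lt_succ_self _) hd
  rw [← h, ← h3] at h4
  nlinarith

/-- If all blocks have size `d`, then the zero block has the complementary size. -/
theorem card_zero_eq {p : PrePartition n r} (h : ∀ B ∈ p.blocks, B.card = d) :
    p.blocks.card * d + p.zero.card = n := by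
  have h1 := p.sum_card_blocks
  rwa [Finset.sum_congr rfl h, Finset.sum_const, smul_eq_mul] at h1

/-- An admissible prepartition with fewer than `n / d` blocks arises by a merge from an admissible
one: a large block splits into two, and a large zero block splits off a block. -/
theorem IsAdmissible.exists_merge [NeZero k] {p : PrePartition n r} (hp : p.IsAdmissible d φ)
    (hd : 1 ≤ d) (hkd : k ∣ d) (h : p.blocks.card < n / d) :
    ∃ q : PrePartition n r, q.IsAdmissible d φ ∧ (q.MergeZero p ∨ q.MergeNonzero p) := by
  by_cases hall : ∀ B ∈ p.blocks, B.card = d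
  · have h1 := card_zero_eq hall
    have h2 : (p.blocks.card + 1) * d ≤ n := (Nat.le_div_iff_mul_le hd).1 h
    rw [Nat.add_mul, one_mul] at h2
    obtain ⟨B, hB, hcard⟩ := Finset.exists_subset_card_eq (s := p.zero) (n := d) (by omega)
    obtain ⟨γ, hγ⟩ := exists_evenlyColoured φ B (hcard ▸ hkd)
    have hBne : B.Nonempty := Finset.card_pos.1 (by omega)
    have hout : ∀ C ∈ p.blocks, ∀ a ∈ C, a ∉ B := fun C hC a ha haB =>
      notMem_zero_of_mem hC ha (hB haB)
    have hBnot : B ∉ p.blocks := fun h => by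
      obtain ⟨a, ha⟩ := hBne
      exact hout B h a ha ha
    let q : PrePartition n r := ofBlocks (insert B p.blocks)
      (fun C hC => by
        rcases Finset.mem_insert.1 hC with rfl | hC
        · exact hBne
        · exact nonempty_of_mem_blocks hC)
      (fun C hC D hD a haC haD => by
        rcases Finset.mem_insert.1 hC with rfl | hC' <;>
          rcases Finset.mem_insert.1 hD with rfl | hD'
        · rfl
        · exact absurd haC (hout D hD' a haD)
        · exact absurd haD (hout C hC' a haC)
        · exact eq_of_mem_blocks hC' hD' haC haD)
      (fun a => if a ∈ B then γ a else p.label a)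
    refine ⟨q, fun C hC => ?_, Or.inl ⟨B, Finset.mem_insert_self _ _, ?_, ?_, fun a ha => ?_⟩⟩
    · rcases Finset.mem_insert.1 (show C ∈ insert B p.blocks from hC) with rfl | hC
      · exact ⟨hcard ▸ dvd_rfl, hγ.translate (g := 0) fun a ha => by simp [q, ofBlocks, ha]⟩
      · exact ⟨(hp C hC).1, (hp C hC).2.translate (g := 0) fun a ha => by
          simp [q, ofBlocks, hout C hC a ha]⟩
    · ext a
      simp only [q, ofBlocks, Finset.mem_union, Finset.mem_filter, Finset.mem_univ, true_and,
        Finset.mem_insert, forall_eq_or_imp]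
      constructor
      · intro ha
        by_cases haB : a ∈ B
        · exact Or.inr haB
        · exact Or.inl ⟨haB, fun C hC haC => notMem_zero_of_mem hC haC ha⟩
      · rintro (⟨-, ha⟩ | ha)
        · by_contra hno
          obtain ⟨C, hC, haC⟩ := exists_mem_blocks hno
          exact ha C hC haC
        · exact hB ha
    · exact (Finset.erase_insert hBnot).symm
    · have haB : a ∉ B := fun h => ha (hB h)
      simp [q, ofBlocks, haB]
  · push Not at hall
    obtain ⟨B, hB, hne⟩ := hall
    obtain ⟨C, hCB, hcard, hC⟩ := (hp B hB).2.exists_subset hkd (hp.le_card hB)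
    have hCne : C.Nonempty := Finset.card_pos.1 (by omega)
    have hDne : (B \ C).Nonempty := Finset.sdiff_nonempty.2 fun hs =>
      hne (by rw [← hcard, hCB.antisymm hs])
    have hCD : Disjoint C (B \ C) := Finset.disjoint_sdiff
    have hU : C ∪ B \ C = B := Finset.union_sdiff_of_subset hCB
    have hmem : ∀ E ∈ insert C (insert (B \ C) (p.blocks.erase B)),
        E = C ∨ E = B \ C ∨ E ∈ p.blocks ∧ E ≠ B := fun E hE => by
      simp only [Finset.mem_insert, Finset.mem_erase] at hE
      tauto
    have hout : ∀ E ∈ p.blocks, E ≠ B → ∀ a ∈ E, a ∉ B := fun E hE hEB a ha haB =>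
      hEB (eq_of_mem_blocks hE hB ha haB)
    let q : PrePartition n r := ofBlocks (insert C (insert (B \ C) (p.blocks.erase B)))
      (fun E hE => by
        rcases hmem E hE with rfl | rfl | hE
        · exact hCne
        · exact hDne
        · exact nonempty_of_mem_blocks hE.1)
      (fun E hE F hF a haE haF => by
        rcases hmem E hE with hE' | hE' | hE' <;> rcases hmem F hF with hF' | hF' | hF'
        · rw [hE', hF']
        · exact absurd (hF' ▸ haF) (Finset.disjoint_left.1 hCD (hE' ▸ haE))
        · exact absurd (hCB (hE' ▸ haE)) (hout F hF'.1 hF'.2 a haF)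
        · exact absurd (hE' ▸ haE) (Finset.disjoint_left.1 hCD (hF' ▸ haF))
        · rw [hE', hF']
        · exact absurd (Finset.sdiff_subset (hE' ▸ haE)) (hout F hF'.1 hF'.2 a haF)
        · exact absurd (hCB (hF' ▸ haF)) (hout E hE'.1 hE'.2 a haE)
        · exact absurd (Finset.sdiff_subset (hF' ▸ haF)) (hout E hE'.1 hE'.2 a haE)
        · exact eq_of_mem_blocks hE'.1 hF'.1 haE haF)
      p.label
    have hqb : q.blocks = insert C (insert (B \ C) (p.blocks.erase B)) := rfl
    have hCnot : C ∉ p.blocks.erase B := fun h => by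
      obtain ⟨a, ha⟩ := hCne
      exact hout C (Finset.mem_of_mem_erase h) (Finset.ne_of_mem_erase h) a ha (hCB ha)
    have hDnot : B \ C ∉ p.blocks.erase B := fun h => by
      obtain ⟨a, ha⟩ := hDne
      exact hout _ (Finset.mem_of_mem_erase h) (Finset.ne_of_mem_erase h) a ha
        (Finset.sdiff_subset ha)
    have hCDne : C ≠ B \ C := fun h => by
      obtain ⟨a, ha⟩ := hCne
      exact Finset.disjoint_left.1 hCD ha (h ▸ ha)
    refine ⟨q, fun E hE => ?_, Or.inr ⟨C, Finset.mem_insert_self _ _, B \ C,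
      Finset.mem_insert_of_mem (Finset.mem_insert_self _ _), hCDne, 0, ?_, ?_,
      fun a _ => by simp [q, ofBlocks], fun a _ _ => rfl⟩⟩
    · rcases hmem E hE with rfl | rfl | hE
      · exact ⟨hcard ▸ dvd_rfl, hC⟩
      · refine ⟨?_, (hp B hB).2.sdiff hC hCB⟩
        rw [Finset.card_sdiff_of_subset hCB, hcard]
        exact Nat.dvd_sub (hp B hB).1 dvd_rfl
      · exact hp E hE.1
    · ext a
      simp only [q, ofBlocks, Finset.mem_filter, Finset.mem_univ, true_and]
      constructor
      · intro ha E hE haE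
        rcases hmem E hE with rfl | rfl | hE
        · exact notMem_zero_of_mem hB (hCB haE) ha
        · exact notMem_zero_of_mem hB (Finset.sdiff_subset haE) ha
        · exact notMem_zero_of_mem hE.1 haE ha
      · intro ha
        by_contra hno
        obtain ⟨E, hE, haE⟩ := exists_mem_blocks hno
        by_cases hEB : E = B
        · subst hEB
          rw [← hU, Finset.mem_union] at haE
          rcases haE with haE | haE
          · exact ha C (by simp) haE
          · exact ha (E \ C) (by simp) haE
        · exact ha E (by simp [hE, hEB]) haE
    · rw [hqb, hU, Finset.erase_insert (by simp only [Finset.mem_insert, not_or]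
                                           exact ⟨hCDne, hCnot⟩),
        Finset.erase_insert hDnot, Finset.insert_erase hB]

end PrePartition

namespace DowlingLattice

open PrePartition

variable {n r d k : ℕ} {φ : ZMod r →+* ZMod k}

/-- Divisibility and even colouring of a labelled partition. -/
def IsAdmissible (d : ℕ) (φ : ZMod r →+* ZMod k) (x : DowlingLattice n r) : Prop :=
  ∃ p : PrePartition n r, mk p = x ∧ p.IsAdmissible d φ

theorem isAdmissible_mk {p : PrePartition n r} :
    (mk p).IsAdmissible d φ ↔ p.IsAdmissible d φ :=
  ⟨fun ⟨_, hq, h⟩ => h.of_equivalent (mk_eq_mk.1 hq), fun h => ⟨p, rfl, h⟩⟩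

theorem IsAdmissible.merge {x y : DowlingLattice n r} (hx : x.IsAdmissible d φ) (h : Merge x y) :
    y.IsAdmissible d φ := by
  obtain ⟨p, q, rfl, rfl, h⟩ := h
  rw [isAdmissible_mk] at hx ⊢
  rcases h with ⟨B, -, hz, hb, hl⟩ | ⟨B, hB, C, hC, hBC, g, hz, hb, hlC, hl⟩
  · intro D hD
    have hD' := hx D (Finset.mem_of_mem_erase (hb ▸ hD))
    exact ⟨hD'.1, hD'.2.translate (g := 0) fun a ha => by
      rw [hl a (notMem_zero_of_mem hD ha), add_zero]⟩
  · have hbal : ∀ D ∈ p.blocks, D ≠ C → EvenlyColoured φ D q.label := fun D hD hDC =>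
      (hx D hD).2.translate (g := 0) fun a ha => by
        rw [hl a (hz ▸ notMem_zero_of_mem hD ha) fun haC => hDC (eq_of_mem_blocks hD hC ha haC),
          add_zero]
    intro D hD
    rw [hb, Finset.mem_insert] at hD
    rcases hD with rfl | hD
    · have hdis : Disjoint B C := p.part.disjoint hB hC hBC
      refine ⟨?_, (hbal B hB hBC).union ((hx C hC).2.translate hlC) hdis⟩
      rw [Finset.card_union_of_disjoint hdis]
      exact dvd_add (hx B hB).1 (hx C hC).1
    · have hD' := Finset.mem_of_mem_erase (Finset.mem_of_mem_erase hD)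
      exact ⟨(hx D hD').1, hbal D hD' (Finset.ne_of_mem_erase hD)⟩

/-- The admissible labelled partitions form an upper set of the Dowling lattice. -/
theorem IsAdmissible.mono {x y : DowlingLattice n r} (hx : x.IsAdmissible d φ) (h : x ≤ y) :
    y.IsAdmissible d φ := by
  have h' : Relation.ReflTransGen Merge x y := h
  induction h' with
  | refl => exact hx
  | tail hxz hzy ih => exact (ih hxz).merge hzy

theorem isAdmissible_one (φ : ZMod r →+* ZMod 1) (x : DowlingLattice n r) :
    x.IsAdmissible 1 φ := by
  obtain ⟨p, rfl⟩ := exists_mk x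
  exact isAdmissible_mk.2 fun B _ => ⟨one_dvd _, fun u v => by rw [Subsingleton.elim u v]⟩

theorem not_isAdmissible_bot (hn : 1 ≤ n) (hd : 2 ≤ d) :
    ¬ (⊥ : DowlingLattice n r).IsAdmissible d φ := fun h => by
  have h' : (finest n r).IsAdmissible d φ := isAdmissible_mk.1 h
  have := (h' {⟨0, hn⟩} (Finpartition.mem_bot_iff.2 ⟨⟨0, hn⟩, by simp [finest], rfl⟩)).1
  rw [Finset.card_singleton] at this
  have := Nat.le_of_dvd one_pos this
  omega

theorem numBlocks_bot : (⊥ : DowlingLattice n r).numBlocks = n := by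
  change (⊥ : Finpartition (∅ᶜ : Finset (Fin n))).parts.card = n
  rw [Finpartition.card_bot]
  simp

theorem IsAdmissible.numBlocks_le_div {x : DowlingLattice n r} (hd : 1 ≤ d)
    (hx : x.IsAdmissible d φ) : x.numBlocks ≤ n / d := by
  obtain ⟨p, rfl, hp⟩ := hx
  exact (Nat.le_div_iff_mul_le hd).2 hp.card_mul_le

theorem IsAdmissible.exists_merge [NeZero k] {x : DowlingLattice n r} (hx : x.IsAdmissible d φ)
    (hd : 1 ≤ d) (hkd : k ∣ d) (h : x.numBlocks < n / d) :
    ∃ y : DowlingLattice n r, y.IsAdmissible d φ ∧ Merge y x := by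
  obtain ⟨p, rfl, hp⟩ := hx
  obtain ⟨q, hq, hM⟩ := hp.exists_merge hd hkd h
  exact ⟨mk q, ⟨q, rfl, hq⟩, q, p, rfl, rfl, hM⟩

end DowlingLattice

/-! ### Rank and upper intervals of the evenly coloured Dowling lattice -/

namespace EvenDowlingLattice

open DowlingLattice

variable {n r d k : ℕ}

instance [NeZero r] : Finite (EvenDowlingLattice n r d k) :=
  inferInstanceAs (Finite {x : DowlingLattice n r // x = ⊥ ∨
    ∃ p : PrePartition n r, DowlingLattice.mk p = x ∧ p.IsDivisible d ∧ p.IsEvenlyColoured k})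

theorem le_iff {x y : EvenDowlingLattice n r d k} : x ≤ y ↔ x.1 ≤ y.1 := Iff.rfl

theorem lt_iff {x y : EvenDowlingLattice n r d k} : x < y ↔ x.1 < y.1 := Iff.rfl

variable (n d) in
/-- The length of the evenly coloured Dowling lattice. -/
def length : ℕ := if d = 1 then n else n / d + 1

open Classical in
/-- The rank of an element, in terms of its number of nonzero blocks. -/
noncomputable def rank (x : EvenDowlingLattice n r d k) : ℕ :=
  if x = ⊥ then 0 else length n d - x.numBlocks

theorem bot_ne_top (hn : 1 ≤ n) : (⊥ : EvenDowlingLattice n r d k) ≠ ⊤ := fun h => by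
  have h1 : (⊥ : DowlingLattice n r) = ⊤ := congrArg Subtype.val h
  have h2 : (⊤ : DowlingLattice n r).numBlocks = 0 := Finset.card_empty
  rw [← h1, numBlocks_bot] at h2
  omega

theorem rank_bot : rank (⊥ : EvenDowlingLattice n r d k) = 0 := if_pos rfl

variable [NeZero r] [NeZero k]

/-- An admissible labelled partition, as an element of the evenly coloured Dowling lattice. -/
def ofAdmissible (hkr : k ∣ r) (x : DowlingLattice n r)
    (hx : x.IsAdmissible d (ZMod.castHom hkr (ZMod k))) : EvenDowlingLattice n r d k :=
  ⟨x, Or.inr (by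
    obtain ⟨p, hp, h⟩ := hx
    exact ⟨p, hp, (PrePartition.isAdmissible_castHom_iff hkr p).1 h⟩)⟩

theorem isAdmissible_of_ne_bot (hkr : k ∣ r) {x : EvenDowlingLattice n r d k} (hx : x ≠ ⊥) :
    x.1.IsAdmissible d (ZMod.castHom hkr (ZMod k)) := by
  rcases x.2 with h | ⟨p, hp, h⟩
  · exact absurd (Subtype.ext h) hx
  · exact ⟨p, hp, (PrePartition.isAdmissible_castHom_iff hkr p).2 h⟩

/-- The covers of an admissible element are the same as in the Dowling lattice, since the admissible
elements form an upper set. -/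
theorem covBy_iff_merge (hkr : k ∣ r) {x y : EvenDowlingLattice n r d k}
    (hx : x.1.IsAdmissible d (ZMod.castHom hkr (ZMod k))) : x ⋖ y ↔ Merge x.1 y.1 := by
  constructor
  · intro h
    obtain ⟨z, hxz, hzy⟩ := exists_merge_le_of_lt (lt_iff.1 h.lt)
    have hlt : x.1 < z := lt_of_le_of_ne hxz.le fun h => by
      have := hxz.numBlocks_eq
      rw [h] at this
      omega
    rcases eq_or_lt_of_le hzy with rfl | hzy
    · exact hxz
    · exact absurd (lt_iff.2 hzy)
        (h.2 (c := ofAdmissible hkr z (hx.merge hxz)) (lt_iff.2 hlt))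
  · intro h
    have hn := h.numBlocks_eq
    refine ⟨lt_iff.2 (lt_of_le_of_ne h.le fun he => ?_), fun z hxz hzy => ?_⟩
    · rw [he] at hn
      omega
    · have h1 := numBlocks_strictAnti (lt_iff.1 hxz)
      have h2 := numBlocks_strictAnti (lt_iff.1 hzy)
      omega

/-- For admissible `x`, the interval `[x, ⊤]` is an interval of the Dowling lattice; by
semimodularity, every enumeration of its atoms is a recursive atom ordering. -/
theorem isRecursiveAtomOrdering_of_isAdmissible (hkr : k ∣ r) (x : EvenDowlingLattice n r d k)
    (hx : x.1.IsAdmissible d (ZMod.castHom hkr (ZMod k))) (hxt : x ≠ ⊤) (t : ℕ)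
    (a : Fin t → EvenDowlingLattice n r d k) (inj : Function.Injective a)
    (atoms : Set.range a = {y | x ⋖ y}) : IsRecursiveAtomOrdering x a := by
  refine isRecursiveAtomOrdering_of_semimodular x hxt (fun x' a b y hxx' ha hb hab hay hby => ?_)
    t a inj atoms
  have hx' := hx.mono (le_iff.1 hxx')
  rw [covBy_iff_merge hkr hx'] at ha hb
  obtain ⟨z, hz, hbz, hzy⟩ := exists_merge_of_merge ha hb (fun h => hab (Subtype.ext h))
    (le_iff.1 hay) (le_iff.1 hby)
  have haa := hx'.merge ha
  refine ⟨ofAdmissible hkr z (haa.merge hz), (covBy_iff_merge hkr haa).2 hz,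
    lt_iff.2 (lt_of_le_of_ne hbz fun h => ?_), hzy⟩
  have h1 := ha.numBlocks_eq
  have h2 := hb.numBlocks_eq
  have h3 : a.1.numBlocks = b.1.numBlocks + 1 := hz.numBlocks_eq.trans (by rw [show b.1 = z from h])
  omega

theorem isLatticePoset (hkr : k ∣ r) : IsLatticePoset (EvenDowlingLattice n r d k) := by
  refine isLatticePoset_of_exists_isLUB fun x y => ?_
  by_cases hx : x = ⊥
  · exact ⟨y, isLUB_pair_iff.2 fun z => by simp [hx]⟩
  · obtain ⟨z, hz⟩ := DowlingLattice.exists_isLUB x.1 y.1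
    have hxz : x.1 ≤ z := hz.1 (by simp)
    refine ⟨ofAdmissible hkr z ((isAdmissible_of_ne_bot hkr hx).mono hxz),
      isLUB_pair_iff.2 fun t => ?_⟩
    exact isLUB_pair_iff.1 hz t.1

theorem numBlocks_lt_length (hkr : k ∣ r) (hd : 1 ≤ d) {x : EvenDowlingLattice n r d k}
    (hx : x ≠ ⊥) : x.numBlocks < length n d := by
  rw [length]
  split_ifs with h
  · have := numBlocks_strictAnti (lt_iff.1 (bot_lt_iff_ne_bot.2 hx))
    exact this.trans_eq numBlocks_bot
  · exact Nat.lt_succ_of_le ((isAdmissible_of_ne_bot hkr hx).numBlocks_le_div hd)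

theorem rank_add_numBlocks (hkr : k ∣ r) (hd : 1 ≤ d) {x : EvenDowlingLattice n r d k}
    (hx : x ≠ ⊥) : x.rank + x.numBlocks = length n d := by
  have := numBlocks_lt_length hkr hd hx
  rw [rank, if_neg hx]
  omega

theorem rank_strictMono (hkr : k ∣ r) (hd : 1 ≤ d) :
    StrictMono (rank : EvenDowlingLattice n r d k → ℕ) := by
  intro x y hxy
  have hy : y ≠ ⊥ := (bot_le.trans_lt hxy).ne'
  have h1 := rank_add_numBlocks hkr hd hy
  by_cases hx : x = ⊥
  · have h2 := numBlocks_lt_length hkr hd hy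
    rw [hx, rank_bot]
    omega
  · have h2 := rank_add_numBlocks hkr hd hx
    have h3 : y.numBlocks < x.numBlocks := numBlocks_strictAnti (lt_iff.1 hxy)
    omega

theorem exists_between_of_rank (hkr : k ∣ r) (hn : 1 ≤ n) (hd : 1 ≤ d) (hkd : k ∣ d)
    (x y : EvenDowlingLattice n r d k) (hxy : x < y) (hr : x.rank + 1 < y.rank) :
    ∃ z, x < z ∧ z < y := by
  have hy : y ≠ ⊥ := (bot_le.trans_lt hxy).ne'
  have hry := rank_add_numBlocks hkr hd hy
  by_cases hx : x.1.IsAdmissible d (ZMod.castHom hkr (ZMod k))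
  · obtain ⟨z, hxz, hzy⟩ := exists_merge_le_of_lt (lt_iff.1 hxy)
    have hlt : x.1 < z := lt_of_le_of_ne hxz.le fun h => by
      have := hxz.numBlocks_eq
      rw [h] at this
      omega
    refine ⟨ofAdmissible hkr z (hx.merge hxz), lt_iff.2 hlt, lt_iff.2 (lt_of_le_of_ne hzy ?_)⟩
    intro h
    have h1 : x.numBlocks = y.numBlocks + 1 :=
      hxz.numBlocks_eq.trans (by rw [show z = y.1 from h]; rfl)
    by_cases hxb : x = ⊥
    · -- The minimum is admissible only for `d = 1`.
      subst hxb
      have hd1 : d = 1 := by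
        by_contra hne
        exact not_isAdmissible_bot hn (by omega) hx
      have h2 : (⊥ : EvenDowlingLattice n r d k).numBlocks = n := numBlocks_bot
      rw [rank_bot] at hr
      rw [length, if_pos hd1] at hry
      omega
    · have h2 := rank_add_numBlocks hkr hd hxb
      omega
  · obtain rfl : x = ⊥ := by
      by_contra h
      exact hx (isAdmissible_of_ne_bot hkr h)
    have hd1 : d ≠ 1 := by
      rintro rfl
      obtain rfl : k = 1 := Nat.dvd_one.1 hkd
      exact hx (isAdmissible_one _ _)
    rw [rank_bot] at hr
    rw [length, if_neg hd1] at hry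
    obtain ⟨z, hz, hM⟩ := (isAdmissible_of_ne_bot hkr hy).exists_merge hd hkd
      (show y.numBlocks < n / d by omega)
    refine ⟨ofAdmissible hkr z hz, bot_lt_iff_ne_bot.2 fun h => ?_,
      ((covBy_iff_merge hkr (x := ofAdmissible hkr z hz) hz).2 hM).lt⟩
    exact hx ((congrArg Subtype.val h : z = ⊥) ▸ hz)

theorem bot_covBy_iff (hkr : k ∣ r) (hn : 1 ≤ n) (hd : 1 ≤ d) (hkd : k ∣ d)
    {x : EvenDowlingLattice n r d k} : ⊥ ⋖ x ↔ x.rank = 1 := by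
  have hmono := rank_strictMono (n := n) hkr hd
  constructor
  · intro h
    have h1 := hmono h.lt
    rw [rank_bot] at h1
    by_contra hne
    obtain ⟨z, h2, h3⟩ := exists_between_of_rank hkr hn hd hkd ⊥ x h.lt (by rw [rank_bot]; omega)
    exact h.2 h2 h3
  · intro h
    refine ⟨bot_lt_iff_ne_bot.2 fun hx => ?_, fun z h1 h2 => ?_⟩
    · rw [hx, rank_bot] at h
      omega
    · have h3 := hmono h1
      have h4 := hmono h2
      omega

end EvenDowlingLattice

/-! ### Keys for ordering the atoms -/

namespace PrePartition

variable {n r d k : ℕ}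

/-- The nonzero block of `a`, or the empty set if `a` lies in the zero block. -/
def blockOf (p : PrePartition n r) (a : Fin n) : Finset (Fin n) :=
  (p.blocks.filter (a ∈ ·)).sup id

theorem blockOf_eq {p : PrePartition n r} {B : Finset (Fin n)} {a : Fin n} (hB : B ∈ p.blocks)
    (ha : a ∈ B) : p.blockOf a = B := by
  have : p.blocks.filter (a ∈ ·) = {B} := by
    ext C
    simp only [Finset.mem_filter, Finset.mem_singleton]
    exact ⟨fun h => eq_of_mem_blocks h.1 hB h.2 ha, by rintro rfl; exact ⟨hB, ha⟩⟩
  rw [blockOf, this, Finset.sup_singleton, id]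

theorem blockOf_eq_empty {p : PrePartition n r} {a : Fin n} (ha : a ∈ p.zero) :
    p.blockOf a = ∅ := by
  have : p.blocks.filter (a ∈ ·) = ∅ :=
    Finset.filter_eq_empty_iff.2 fun B hB h => notMem_zero_of_mem hB h ha
  rw [blockOf, this, Finset.sup_empty, Finset.bot_eq_empty]

/-- The labels normalized, on each nonzero block, to vanish at a chosen element of that block; as
natural numbers, and `0` on the zero block. Thus the normalized labels depend only on the
equivalence class. -/
noncomputable def normLabel (p : PrePartition n r) (a : Fin n) : ℕ :=
  if h : (p.blockOf a).Nonempty then (p.label a - p.label h.choose).val else 0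

theorem normLabel_of_mem {p : PrePartition n r} {B : Finset (Fin n)} {a : Fin n}
    (hB : B ∈ p.blocks) (ha : a ∈ B) :
    p.normLabel a = (p.label a - p.label (nonempty_of_mem_blocks hB).choose).val := by
  obtain rfl := blockOf_eq hB ha
  rw [normLabel, dif_pos (nonempty_of_mem_blocks hB)]

theorem normLabel_of_mem_zero {p : PrePartition n r} {a : Fin n} (ha : a ∈ p.zero) :
    p.normLabel a = 0 := by
  rw [normLabel, dif_neg]
  simp [blockOf_eq_empty ha]

theorem normLabel_eq_of_translate {p q : PrePartition n r} {B : Finset (Fin n)} {a : Fin n}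
    (hp : B ∈ p.blocks) (hq : B ∈ q.blocks) {g : ZMod r}
    (h : ∀ a ∈ B, q.label a = p.label a + g) (ha : a ∈ B) : q.normLabel a = p.normLabel a := by
  rw [normLabel_of_mem hp ha, normLabel_of_mem hq ha, h a ha,
    h _ (nonempty_of_mem_blocks hp).choose_spec, add_sub_add_right_eq_sub]

/-- The sorted list of the nonzero blocks, each of them a sorted list. -/
def blockList (p : PrePartition n r) : List (List (Fin n)) :=
  (p.blocks.image fun B => B.sort).sort

/-- The key by which atoms are ordered: the zero block, then the nonzero blocks, then the normalized
labels. -/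
noncomputable def key (p : PrePartition n r) :
    List (Fin n) ×ₗ List (List (Fin n)) ×ₗ Lex (Fin n → ℕ) :=
  toLex (p.zero.sort, toLex (p.blockList, toLex p.normLabel))

theorem key_lt_key {p q : PrePartition n r} : p.key < q.key ↔
    p.zero.sort < q.zero.sort ∨ p.zero.sort = q.zero.sort ∧ (p.blockList < q.blockList ∨
      p.blockList = q.blockList ∧ toLex p.normLabel < toLex q.normLabel) := by
  rw [key, key, Prod.Lex.toLex_lt_toLex, Prod.Lex.toLex_lt_toLex]

theorem Equivalent.key_eq {p q : PrePartition n r} (h : p.Equivalent q) : p.key = q.key := by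
  have hl : p.normLabel = q.normLabel := by
    funext a
    by_cases ha : a ∈ p.zero
    · rw [normLabel_of_mem_zero ha, normLabel_of_mem_zero (h.1 ▸ ha)]
    · obtain ⟨B, hB, haB⟩ := exists_mem_blocks ha
      obtain ⟨g, hg⟩ := h.2.2 B hB
      exact (normLabel_eq_of_translate hB (h.2.1 ▸ hB) hg haB).symm
  rw [key, key, blockList, blockList, h.1, h.2.1, hl]

theorem sort_mem_image_sort {𝔅 : Finset (Finset (Fin n))} {B : Finset (Fin n)} :
    B.sort ∈ (𝔅.image fun B => B.sort) ↔ B ∈ 𝔅 := by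
  rw [Finset.mem_image]
  exact ⟨fun ⟨C, hC, h⟩ => Finset.sort_injective h ▸ hC, fun h => ⟨B, h, rfl⟩⟩

theorem card_image_sort (𝔅 : Finset (Finset (Fin n))) :
    (𝔅.image fun B => B.sort).card = 𝔅.card :=
  Finset.card_image_of_injective _ Finset.sort_injective

/-- Block lists of the same length are compared by the lexicographically first block that belongs to
only one of them. -/
theorem blockList_lt_blockList {p q : PrePartition n r} (h : p.blocks.card = q.blocks.card) :
    p.blockList < q.blockList ↔ ∃ A ∈ p.blocks, A ∉ q.blocks ∧
      ∀ D : Finset (Fin n), D.sort < A.sort → (D ∈ p.blocks ↔ D ∈ q.blocks) := by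
  rw [blockList, blockList, Finset.sort_lt_sort_iff (by rw [card_image_sort, card_image_sort, h])]
  constructor
  · rintro ⟨e, he, heq, hlt⟩
    obtain ⟨A, hA, rfl⟩ := Finset.mem_image.1 he
    refine ⟨A, hA, fun h => heq (sort_mem_image_sort.2 h), fun D hD => ?_⟩
    have := hlt _ hD
    rwa [sort_mem_image_sort, sort_mem_image_sort] at this
  · rintro ⟨A, hA, hAq, hlt⟩
    refine ⟨A.sort, sort_mem_image_sort.2 hA, fun h => hAq (sort_mem_image_sort.1 h),
      fun x hx => ?_⟩
    constructor
    · intro h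
      obtain ⟨D, hD, rfl⟩ := Finset.mem_image.1 h
      exact sort_mem_image_sort.2 ((hlt D hx).1 hD)
    · intro h
      obtain ⟨D, hD, rfl⟩ := Finset.mem_image.1 h
      exact sort_mem_image_sort.2 ((hlt D hx).2 hD)

theorem blockList_inj {p q : PrePartition n r} (h : p.blockList = q.blockList) :
    p.blocks = q.blocks :=
  Finset.image_injective Finset.sort_injective (Finset.sort_injective h)

/-- A set that contains an element smaller than all elements of another set precedes it. -/
theorem sort_lt_sort_of_forall_lt {A D : Finset (Fin n)} (hcard : D.card = A.card) {c : Fin n}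
    (hc : c ∈ D) (h : ∀ a ∈ A, c < a) : D.sort < A.sort := by
  refine (Finset.sort_lt_sort_iff hcard).2 ⟨D.min' ⟨c, hc⟩, D.min'_mem _, fun hA => ?_,
    fun x hx => ?_⟩
  · exact (h _ hA).not_ge (D.min'_le c hc)
  · exact ⟨fun hxD => absurd (D.min'_le x hxD) (not_le.2 hx),
      fun hxA => absurd ((h x hxA).trans hx) (not_lt.2 (D.min'_le c hc))⟩

theorem equivalent_of_key_eq [NeZero r] {p q : PrePartition n r} (h : p.key = q.key) :
    p.Equivalent q := by
  have hz : p.zero.sort = q.zero.sort := congrArg (fun x => (ofLex x).1) h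
  have hb : p.blocks = q.blocks := blockList_inj (congrArg (fun x => (ofLex (ofLex x).2).1) h)
  have hl : p.normLabel = q.normLabel :=
    congrArg (fun x => ofLex (ofLex (ofLex x).2).2) h
  refine ⟨Finset.sort_injective hz, hb, fun B hB => ?_⟩
  have hc := nonempty_of_mem_blocks hB
  refine ⟨q.label hc.choose - p.label hc.choose, fun a ha => ?_⟩
  have h1 := congrFun hl a
  rw [normLabel_of_mem hB ha, normLabel_of_mem (hb ▸ hB) ha] at h1
  have h2 : q.label a = q.label hc.choose + (p.label a - p.label hc.choose) :=
    sub_eq_iff_eq_add'.1 (ZMod.val_injective r h1).symm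
  rw [h2]
  abel

/-! ### Atoms -/

/-- A representative of an atom, for `d ≥ 2`: an admissible prepartition with the largest possible
number of nonzero blocks. -/
def IsAtomic (d : ℕ) (φ : ZMod r →+* ZMod k) (p : PrePartition n r) : Prop :=
  p.IsAdmissible d φ ∧ p.blocks.card = n / d

variable {φ : ZMod r →+* ZMod k}

theorem IsAtomic.card_eq {p : PrePartition n r} (hp : p.IsAtomic d φ) (hd : 1 ≤ d)
    {B : Finset (Fin n)} (hB : B ∈ p.blocks) : B.card = d :=
  hp.1.card_eq hd hp.2 hB

theorem IsAtomic.card_zero_eq {p q : PrePartition n r} (hp : p.IsAtomic d φ)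
    (hq : q.IsAtomic d φ) (hd : 1 ≤ d) : p.zero.card = q.zero.card := by
  have h1 := PrePartition.card_zero_eq (p := p) fun B hB => hp.card_eq hd hB
  have h2 := PrePartition.card_zero_eq (p := q) fun B hB => hq.card_eq hd hB
  rw [hp.2] at h1
  rw [hq.2] at h2
  omega

/-- For atoms, the order by keys refines the lexicographic order of the words. -/
theorem IsAtomic.word_le {p q : PrePartition n r} (hp : p.IsAtomic d φ) (hq : q.IsAtomic d φ)
    (hd : 1 ≤ d) (h : p.key ≤ q.key) : p.word ≤ q.word := by
  have hlen : ∀ {s : PrePartition n r}, s.IsAtomic d φ → ∀ l ∈ s.blockList, l.length = d := by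
    intro s hs l hl
    rw [blockList, Finset.mem_sort] at hl
    obtain ⟨B, hB, rfl⟩ := Finset.mem_image.1 hl
    rw [Finset.length_sort, hs.card_eq hd hB]
  have h' : p.zero.sort < q.zero.sort ∨ p.zero.sort = q.zero.sort ∧ p.blockList ≤ q.blockList := by
    rcases h.lt_or_eq with h | h
    · exact (key_lt_key.1 h).imp id fun h => ⟨h.1, h.2.elim le_of_lt fun h => h.1.le⟩
    · have h1 := congrArg (fun x => (ofLex x).1) h
      have h2 := congrArg (fun x => (ofLex (ofLex x).2).1) h
      exact Or.inr ⟨h1, le_of_eq h2⟩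
  exact List.append_le_append_of_le
    (by rw [Finset.length_sort, Finset.length_sort, hp.card_zero_eq hq hd])
    (h'.imp id fun h => ⟨h.1, List.flatten_le_flatten_of_le (hlen hp) (hlen hq) h.2⟩)

/-- The prepartition with the blocks of `p` permuted by `σ`, and with labels `γ`. -/
def permute (p : PrePartition n r) (σ : Equiv.Perm (Fin n)) (γ : Fin n → ZMod r) :
    PrePartition n r :=
  ofBlocks (p.blocks.image (Finset.image σ))
    (fun B hB => by
      obtain ⟨C, hC, rfl⟩ := Finset.mem_image.1 hB
      exact (nonempty_of_mem_blocks hC).image σ)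
    (fun B hB C hC a haB haC => by
      obtain ⟨B', hB', rfl⟩ := Finset.mem_image.1 hB
      obtain ⟨C', hC', rfl⟩ := Finset.mem_image.1 hC
      obtain ⟨b, hb, rfl⟩ := Finset.mem_image.1 haB
      obtain ⟨c, hc, h⟩ := Finset.mem_image.1 haC
      rw [σ.injective h] at hc
      rw [eq_of_mem_blocks hB' hC' hb hc])
    γ

theorem mem_blocks_permute {p : PrePartition n r} {σ : Equiv.Perm (Fin n)} {γ : Fin n → ZMod r}
    {B : Finset (Fin n)} : B ∈ (p.permute σ γ).blocks ↔ ∃ C ∈ p.blocks, C.image σ = B :=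
  Finset.mem_image

theorem mem_zero_permute {p : PrePartition n r} {σ : Equiv.Perm (Fin n)} {γ : Fin n → ZMod r}
    {a : Fin n} : σ a ∈ (p.permute σ γ).zero ↔ a ∈ p.zero := by
  have h : σ a ∈ (p.permute σ γ).zero ↔ ∀ B ∈ p.blocks, a ∉ B := by
    simp [permute, ofBlocks]
  rw [h]
  constructor
  · intro h
    by_contra hno
    obtain ⟨B, hB, ha⟩ := exists_mem_blocks hno
    exact h B hB ha
  · exact fun h B hB ha => notMem_zero_of_mem hB ha h

theorem IsAtomic.permute {p : PrePartition n r} (hp : p.IsAtomic d φ) {σ : Equiv.Perm (Fin n)}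
    {γ : Fin n → ZMod r} (h : ∀ B ∈ p.blocks, ∀ a ∈ B, φ (γ (σ a)) = φ (p.label a)) :
    (p.permute σ γ).IsAtomic d φ := by
  refine ⟨fun B hB => ?_, ?_⟩
  · obtain ⟨C, hC, rfl⟩ := mem_blocks_permute.1 hB
    refine ⟨?_, (hp.1 C hC).2.image σ.injective (h C hC)⟩
    rw [Finset.card_image_of_injective _ σ.injective]
    exact (hp.1 C hC).1
  · rw [← hp.2]
    exact Finset.card_image_of_injective _ (Finset.image_injective σ.injective)

theorem image_swap_of_notMem {B : Finset (Fin n)} {e f : Fin n} (he : e ∉ B) (hf : f ∉ B) :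
    B.image (Equiv.swap e f) = B := by
  conv_rhs => rw [← Finset.image_id (s := B)]
  exact Finset.image_congr fun a ha => Equiv.swap_apply_of_ne_of_ne
    (fun h => he (h ▸ ha)) (fun h => hf (h ▸ ha))

/-! ### Earlier atoms below a common upper bound -/

/-- The exchange property that makes the ordering of atoms recursive: `p` has a cover below `q`
which lies above an atom that precedes `p`. -/
def HasExchange (d : ℕ) (φ : ZMod r →+* ZMod k) (p q : PrePartition n r) : Prop :=
  ∃ s z : PrePartition n r, s.IsAtomic d φ ∧ s.key < p.key ∧
    DowlingLattice.Merge (DowlingLattice.mk p) (DowlingLattice.mk z) ∧ s.Refines z ∧ z.Refines q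

/-- If the zero block of `p'` precedes that of `p`, an element `e` of a nonzero block `B` of `p`
is exchanged with a larger element `f` of the zero block, and `B` is merged into the zero block. -/
theorem hasExchange_of_zero_lt {p p' q : PrePartition n r} (hp : p.IsAtomic d φ)
    (hp' : p'.IsAtomic d φ) (hd : 1 ≤ d) (hpq : p.Refines q) (hp'q : p'.Refines q)
    (hlt : p'.zero.sort < p.zero.sort) : p.HasExchange d φ q := by
  have hcard := hp'.card_zero_eq hp hd
  obtain ⟨e, he', he, hx⟩ := (Finset.sort_lt_sort_iff hcard).1 hlt
  obtain ⟨f, hf, hf'⟩ : ∃ f ∈ p.zero, f ∉ p'.zero := by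
    by_contra hno
    push Not at hno
    exact he (Finset.eq_of_subset_of_card_le hno hcard.le ▸ he')
  have hef : e < f := by
    rcases lt_trichotomy e f with h | rfl | h
    · exact h
    · exact absurd hf he
    · exact absurd ((hx f h).2 hf) hf'
  obtain ⟨B, hB, heB⟩ := exists_mem_blocks he
  have hBq : B ⊆ q.zero := (hpq.2 B hB).resolve_right fun ⟨C, hC, hBC, _⟩ =>
    notMem_zero_of_mem hC (hBC heB) (hp'q.1 he')
  obtain ⟨z, hz, hzb, hzl⟩ := exists_mergeZero p hB
  have hfix : ∀ a, a ≠ e → a ≠ f → Equiv.swap e f a = a := fun a =>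
    Equiv.swap_apply_of_ne_of_ne
  have hs : (p.permute (Equiv.swap e f) (p.label ∘ Equiv.swap e f)).IsAtomic d φ :=
    hp.permute fun C hC a ha => by simp
  refine ⟨p.permute (Equiv.swap e f) (p.label ∘ Equiv.swap e f), z, hs, key_lt_key.2 (Or.inl ?_),
    ⟨p, z, rfl, rfl, Or.inl ⟨B, hB, hz, hzb, by simp [hzl]⟩⟩, ⟨fun a ha => ?_, fun D hD => ?_⟩,
    (refines_iff_of_mergeZero hz hzb (by simp [hzl])).2 ⟨hpq, hBq⟩⟩
  · refine (Finset.sort_lt_sort_iff (hs.card_zero_eq hp hd)).2 ⟨e, ?_, he, fun x hxe => ?_⟩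
    · have h := (mem_zero_permute (σ := Equiv.swap e f) (γ := p.label ∘ Equiv.swap e f)).2 hf
      rwa [Equiv.swap_apply_right] at h
    · conv_lhs => rw [← hfix x hxe.ne (hxe.trans hef).ne, mem_zero_permute]
  · rw [hz, Finset.mem_union]
    rw [← Equiv.swap_apply_self e f a, mem_zero_permute] at ha
    by_cases hae : a = e
    · exact Or.inr (hae ▸ heB)
    by_cases haf : a = f
    · exact Or.inl (haf ▸ hf)
    rw [hfix a hae haf] at ha
    exact Or.inl ha
  · obtain ⟨C, hC, rfl⟩ := mem_blocks_permute.1 hD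
    have hfC : f ∉ C := fun h => notMem_zero_of_mem hC h hf
    by_cases hCB : C = B
    · subst hCB
      refine Or.inl fun a ha => ?_
      obtain ⟨c, hc, rfl⟩ := Finset.mem_image.1 ha
      rw [hz, Finset.mem_union]
      by_cases hce : c = e
      · rw [hce, Equiv.swap_apply_left]
        exact Or.inl hf
      · rw [hfix c hce fun h => hfC (h ▸ hc)]
        exact Or.inr hc
    · have heC : e ∉ C := fun h => hCB (eq_of_mem_blocks hC hB h heB)
      rw [image_swap_of_notMem heC hfC]
      refine Or.inr ⟨C, hzb ▸ Finset.mem_erase.2 ⟨hCB, hC⟩, subset_rfl, 0, fun a ha => ?_⟩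
      simp [hzl, permute, ofBlocks, hfix a (fun h => heC (h ▸ ha)) (fun h => hfC (h ▸ ha))]

/-- Two nonzero blocks `B` and `C` of `p` exchange elements `f ∈ B` and `e ∈ C` of the same
colour. If `e < f` and `C` has no element below some `s ∈ B`, the result precedes `p`; both lie
below the element obtained by merging `B` and `C`. -/
theorem hasExchange_of_mem_blocks {p q : PrePartition n r} (hp : p.IsAtomic d φ) (hd : 1 ≤ d)
    (hpq : p.Refines q) {B C : Finset (Fin n)} (hB : B ∈ p.blocks) (hC : C ∈ p.blocks)
    {s e f : Fin n} (hsB : s ∈ B) (hfB : f ∈ B) (heC : e ∈ C) (heB : e ∉ B)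
    (hCs : ∀ a ∈ C, s ≤ a) (hef : e < f)
    (hcol : φ (p.label e) = φ (p.label f))
    (hq : B ∪ C ⊆ q.zero ∨ ∃ D ∈ q.blocks, B ∪ C ⊆ D ∧
      ∃ h : ZMod r, ∀ a ∈ B ∪ C, q.label a = p.label a + h) : p.HasExchange d φ q := by
  have hBC : B ≠ C := by
    rintro rfl
    exact heB heC
  have hsC : s ∉ C := fun h => hBC (eq_of_mem_blocks hB hC hsB h)
  have hfC : f ∉ C := fun h => hBC (eq_of_mem_blocks hB hC hfB h)
  have hse : s < e := lt_of_le_of_ne (hCs e heC) fun h => heB (h ▸ hsB)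
  have hfix : ∀ a, a ≠ e → a ≠ f → Equiv.swap e f a = a := fun a =>
    Equiv.swap_apply_of_ne_of_ne
  have hother : ∀ D ∈ p.blocks, D ≠ B → D ≠ C → D.image (Equiv.swap e f) = D :=
    fun D hD hDB hDC => image_swap_of_notMem (fun h => hDC (eq_of_mem_blocks hD hC h heC))
      fun h => hDB (eq_of_mem_blocks hD hB h hfB)
  have hs : (p.permute (Equiv.swap e f) p.label).IsAtomic d φ := hp.permute fun D _ a _ => by
    by_cases hae : a = e
    · rw [hae, Equiv.swap_apply_left, hcol]
    by_cases haf : a = f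
    · rw [haf, Equiv.swap_apply_right, hcol]
    rw [hfix a hae haf]
  have hzero : (p.permute (Equiv.swap e f) p.label).zero = p.zero := by
    ext a
    rw [← mem_zero_permute (p := p) (σ := Equiv.swap e f) (γ := p.label)]
    by_cases ha : a = e ∨ a = f
    · have h1 : e ∉ p.zero := notMem_zero_of_mem hC heC
      have h2 : f ∉ p.zero := notMem_zero_of_mem hB hfB
      have h1' := (mem_zero_permute (p := p) (σ := Equiv.swap e f) (γ := p.label)).not.2 h1
      have h2' := (mem_zero_permute (p := p) (σ := Equiv.swap e f) (γ := p.label)).not.2 h2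
      rw [Equiv.swap_apply_left] at h1'
      rw [Equiv.swap_apply_right] at h2'
      rcases ha with rfl | rfl
      · rw [Equiv.swap_apply_left]
        exact iff_of_false h2' h1'
      · rw [Equiv.swap_apply_right]
        exact iff_of_false h1' h2'
    · rw [not_or] at ha
      rw [hfix a ha.1 ha.2]
  obtain ⟨z, hz, hzb, hzl⟩ := exists_mergeNonzero p hB hC 0
  have hzl' : z.label = p.label := by
    rw [hzl]
    funext a
    simp
  refine ⟨p.permute (Equiv.swap e f) p.label, z, hs, key_lt_key.2 (Or.inr ⟨by rw [hzero],
    Or.inl ?_⟩), ⟨p, z, rfl, rfl, Or.inr ⟨B, hB, C, hC, hBC, 0, hz, hzb, by simp [hzl'],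
    by simp [hzl']⟩⟩, ⟨?_, fun D hD => ?_⟩, ?_⟩
  · have hsσ : s ∈ B.image (Equiv.swap e f) :=
      Finset.mem_image.2 ⟨s, hsB, hfix s hse.ne (hse.trans hef).ne⟩
    have heσ : e ∈ B.image (Equiv.swap e f) :=
      Finset.mem_image.2 ⟨f, hfB, Equiv.swap_apply_right e f⟩
    have hcardσ : ∀ D ∈ p.blocks, (D.image (Equiv.swap e f)).card = d := fun D hD => by
      rw [Finset.card_image_of_injective _ (Equiv.injective _), hp.card_eq hd hD]
    have hlt : ∀ a ∈ C, s < a := fun a ha => lt_of_le_of_ne (hCs a ha) fun h => hsC (h ▸ ha)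
    refine (blockList_lt_blockList (hs.2.trans hp.2.symm)).2
      ⟨B.image (Equiv.swap e f), mem_blocks_permute.2 ⟨B, hB, rfl⟩, fun h => ?_, fun D hD => ?_⟩
    · exact heB (eq_of_mem_blocks h hB hsσ hsB ▸ heσ)
    · constructor
      · intro h
        obtain ⟨E, hE, rfl⟩ := mem_blocks_permute.1 h
        by_cases hEB : E = B
        · exact absurd hD (hEB ▸ lt_irrefl _)
        by_cases hEC : E = C
        · refine absurd (sort_lt_sort_of_forall_lt ((hcardσ B hB).trans (hcardσ E hE).symm) hsσ
            fun a ha => ?_) hD.not_gt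
          obtain ⟨c, hc, rfl⟩ := Finset.mem_image.1 ha
          by_cases hce : c = e
          · rw [hce, Equiv.swap_apply_left]
            exact hse.trans hef
          · rw [hfix c hce fun h => hfC (hEC ▸ h ▸ hc)]
            exact hlt c (hEC ▸ hc)
        rwa [hother E hE hEB hEC]
      · intro h
        by_cases hDB : D = B
        · subst hDB
          refine absurd ((Finset.sort_lt_sort_iff ((hcardσ D hB).trans
            (hp.card_eq hd hB).symm)).2 ⟨e, heσ, heB, fun x hxe => ?_⟩) hD.not_gt
          have hσx := hfix x hxe.ne (hxe.trans hef).ne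
          conv_lhs => rw [← hσx, (Equiv.swap e f).injective.mem_finset_image]
        by_cases hDC : D = C
        · subst hDC
          exact absurd (sort_lt_sort_of_forall_lt ((hcardσ B hB).trans
            (hp.card_eq hd hC).symm) hsσ hlt) hD.not_gt
        exact mem_blocks_permute.2 ⟨D, h, hother D h hDB hDC⟩
  · rw [hzero, hz]
  · refine Or.inr ?_
    obtain ⟨E, hE, rfl⟩ := mem_blocks_permute.1 hD
    have hlab : ∀ a ∈ E.image (Equiv.swap e f),
        z.label a = (p.permute (Equiv.swap e f) p.label).label a + 0 := fun a _ => by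
      rw [hzl', add_zero]
      rfl
    by_cases hEBC : E = B ∨ E = C
    · refine ⟨B ∪ C, hzb ▸ Finset.mem_insert_self _ _, fun a ha => ?_, 0, hlab⟩
      obtain ⟨c, hc, rfl⟩ := Finset.mem_image.1 ha
      by_cases hce : c = e
      · rw [hce, Equiv.swap_apply_left]
        exact Finset.mem_union_left _ hfB
      by_cases hcf : c = f
      · rw [hcf, Equiv.swap_apply_right]
        exact Finset.mem_union_right _ heC
      rw [hfix c hce hcf, Finset.mem_union]
      rcases hEBC with h | h
      · exact Or.inl (h ▸ hc)
      · exact Or.inr (h ▸ hc)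
    · rw [not_or] at hEBC
      refine ⟨E, ?_, (hother E hE hEBC.1 hEBC.2).subset, 0, hlab⟩
      rw [hzb]
      exact Finset.mem_insert_of_mem (Finset.mem_erase.2
        ⟨hEBC.2, Finset.mem_erase.2 ⟨hEBC.1, hE⟩⟩)
  · refine (refines_iff_of_mergeNonzero (g := 0) hB hC hBC hz hzb (by simp [hzl'])
      (by simp [hzl'])).2 ⟨hpq, hq.imp id ?_⟩
    rintro ⟨D, hD, hs, h, hh⟩
    exact ⟨D, hD, hs, h, fun a ha => hh a (Finset.mem_union_left _ ha),
      fun a ha => by rw [add_zero, hh a (Finset.mem_union_right _ ha)]⟩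

theorem HasExchange.of_equivalent {p p₂ q : PrePartition n r} (h : p.Equivalent p₂)
    (hex : p₂.HasExchange d φ q) : p.HasExchange d φ q := by
  obtain ⟨s, z, h1, h2, h3, h4, h5⟩ := hex
  exact ⟨s, z, h1, h.key_eq ▸ h2, DowlingLattice.mk_eq_mk.2 h ▸ h3, h4, h5⟩

theorem IsAtomic.of_equivalent {p p₂ : PrePartition n r} (hp : p.IsAtomic d φ)
    (h : p.Equivalent p₂) : p₂.IsAtomic d φ :=
  ⟨hp.1.of_equivalent h, h.2.1 ▸ hp.2⟩

/-- The case that the zero blocks agree, and the nonzero blocks of `p'` precede those of `p`. -/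
theorem hasExchange_of_blockList_lt [NeZero k] {p p' q : PrePartition n r} (hp : p.IsAtomic d φ)
    (hp' : p'.IsAtomic d φ) (hd : 1 ≤ d) (hpq : p.Refines q) (hp'q : p'.Refines q)
    (hzero : p'.zero = p.zero) (hlt : p'.blockList < p.blockList) : p.HasExchange d φ q := by
  -- `A` is the first block of `p'` that is not a block of `p`; `s` is its minimum, and `B` is the
  -- block of `p` that contains `s`.
  obtain ⟨A, hA, hAp, hbefore⟩ := (blockList_lt_blockList (hp'.2.trans hp.2.symm)).1 hlt
  have hAne := nonempty_of_mem_blocks hA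
  obtain ⟨s, hs⟩ : ∃ s, s = A.min' hAne := ⟨_, rfl⟩
  have hsA : s ∈ A := hs ▸ A.min'_mem hAne
  have hAs : ∀ a ∈ A, s ≤ a := fun a ha => hs ▸ A.min'_le a ha
  have hmin : ∀ X ∈ p.blocks, ∀ a ∈ X, a ∈ A → ∀ c ∈ X, s ≤ c := by
    intro X hX a haX haA c hcX
    by_contra hcs
    rw [not_le] at hcs
    obtain ⟨D, hD, hcD⟩ := exists_mem_blocks (hzero ▸ notMem_zero_of_mem hX hcX : c ∉ p'.zero)
    have hDA : D.sort < A.sort := sort_lt_sort_of_forall_lt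
      ((hp'.card_eq hd hD).trans (hp'.card_eq hd hA).symm) hcD fun a ha => hcs.trans_le (hAs a ha)
    obtain rfl : D = X := eq_of_mem_blocks ((hbefore D hDA).1 hD) hX hcD hcX
    obtain rfl : D = A := eq_of_mem_blocks hD hA haX haA
    exact absurd (hAs c hcD) (not_le.2 hcs)
  obtain ⟨B, hB, hsB⟩ := exists_mem_blocks (hzero ▸ notMem_zero_of_mem hA hsA : s ∉ p.zero)
  have hAB : A ≠ B := fun h => hAp (h ▸ hB)
  have hcardAB : A.card = B.card := (hp'.card_eq hd hA).trans (hp.card_eq hd hB).symm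
  have hABlt : A.sort < B.sort := by
    rcases lt_trichotomy A.sort B.sort with h | h | h
    · exact h
    · exact absurd (Finset.sort_injective h) hAB
    · exact absurd (eq_of_mem_blocks hA ((hbefore B h).2 hB) hsA hsB) hAB
  -- `e` is the smallest element of the symmetric difference of `A` and `B`; it lies in `A`.
  obtain ⟨e, heA, heB, hx⟩ := (Finset.sort_lt_sort_iff hcardAB).1 hABlt
  obtain ⟨C, hC, heC⟩ := exists_mem_blocks (hzero ▸ notMem_zero_of_mem hA heA : e ∉ p.zero)
  have hlarge : ∀ f ∈ B, f ∉ A → e < f := fun f hfB hfA => by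
    rcases lt_trichotomy e f with h | rfl | h
    · exact h
    · exact absurd hfB heB
    · exact absurd ((hx f h).2 hfB) hfA
  have hBC : B ≠ C := fun h => heB (h ▸ heC)
  -- Translating the labels on `C` makes the colours of `e` and some `f ∈ B` agree.
  have key : ∀ (g : ZMod r) (f : Fin n), f ∈ B → f ∉ A → φ (p.label e + g) = φ (p.label f) →
      (B ∪ C ⊆ q.zero ∨ ∃ D ∈ q.blocks, B ∪ C ⊆ D ∧ ∃ h : ZMod r,
        (∀ a ∈ B, q.label a = p.label a + h) ∧ ∀ a ∈ C, q.label a = p.label a + g + h) →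
      p.HasExchange d φ q := by
    intro g f hfB hfA hcol hq
    have hBC' : ∀ a ∈ B, a ∉ C := fun a ha ha' => hBC (eq_of_mem_blocks hB hC ha ha')
    have hequiv : p.Equivalent
        ⟨p.zero, p.part, fun a => if a ∈ C then p.label a + g else p.label a⟩ := by
      refine ⟨rfl, rfl, fun D hD => ?_⟩
      by_cases hDC : D = C
      · exact ⟨g, fun a ha => if_pos (hDC ▸ ha)⟩
      · exact ⟨0, fun a ha => by
          rw [add_zero]
          exact if_neg fun h => hDC (eq_of_mem_blocks hD hC ha h)⟩
    refine HasExchange.of_equivalent hequiv (hasExchange_of_mem_blocks (hp.of_equivalent hequiv) hd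
      (hequiv.symm.refines.trans hpq) hB hC hsB hfB heC heB
      (hmin C hC e heC heA) (hlarge f hfB hfA) ?_ (hq.imp id ?_))
    · simpa [heC, hBC' f hfB] using hcol
    · rintro ⟨D, hD, hs, h, hhB, hhC⟩
      refine ⟨D, hD, hs, h, fun a ha => ?_⟩
      rcases Finset.mem_union.1 ha with ha | ha
      · simp [hBC' a ha, hhB a ha]
      · simp [ha, hhC a ha]
  rcases hp'q.2 A hA with hAq | ⟨D, hD, hAD, g', hg'⟩
  · -- In the zero block of `q` labels do not matter, so any translation will do.
    obtain ⟨f, hfB, hfA⟩ : ∃ f ∈ B, f ∉ A := by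
      by_contra hno
      push Not at hno
      exact hAB (Finset.eq_of_subset_of_card_le hno hcardAB.le).symm
    refine key (p.label f - p.label e) f hfB hfA (by rw [add_sub_cancel]) (Or.inl
      (Finset.union_subset ?_ ?_))
    · exact (hpq.2 B hB).resolve_right fun ⟨E, hE, hs, _⟩ =>
        notMem_zero_of_mem hE (hs hsB) (hAq hsA)
    · exact (hpq.2 C hC).resolve_right fun ⟨E, hE, hs, _⟩ =>
        notMem_zero_of_mem hE (hs heC) (hAq heA)
  · obtain ⟨E, hE, hBE, gB, hgB⟩ := (hpq.2 B hB).resolve_left fun hs =>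
      notMem_zero_of_mem hD (hAD hsA) (hs hsB)
    obtain ⟨E', hE', hCE, gC, hgC⟩ := (hpq.2 C hC).resolve_left fun hs =>
      notMem_zero_of_mem hD (hAD heA) (hs heC)
    obtain rfl : E = D := eq_of_mem_blocks hE hD (hBE hsB) (hAD hsA)
    obtain rfl : E' = E := eq_of_mem_blocks hE' hE (hCE heC) (hAD heA)
    -- `A` and `B` contain equally many elements of the colour of `e`, so one of those in `B` is
    -- missing in `A`.
    have hbA := (hp'.1 A hA).2.translate hg'
    have hbB := (hp.1 B hB).2.translate hgB
    have hcnt : (A.filter fun a => φ (q.label a) = φ (q.label e)).card =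
        (B.filter fun a => φ (q.label a) = φ (q.label e)).card :=
      Nat.eq_of_mul_eq_mul_left (Nat.pos_of_ne_zero (NeZero.ne k)) (by
        rw [hbA.mul_card_filter, hbB.mul_card_filter, hcardAB])
    obtain ⟨f, hfB, hfcol, hfA⟩ : ∃ f ∈ B, φ (q.label f) = φ (q.label e) ∧ f ∉ A := by
      by_contra hno
      push Not at hno
      have hsub : (B.filter fun a => φ (q.label a) = φ (q.label e)) ⊆
          A.filter fun a => φ (q.label a) = φ (q.label e) := fun a ha => by
        obtain ⟨h1, h2⟩ := Finset.mem_filter.1 ha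
        exact Finset.mem_filter.2 ⟨hno a h1 h2, h2⟩
      have heq := Finset.eq_of_subset_of_card_le hsub hcnt.le
      have : e ∈ B.filter fun a => φ (q.label a) = φ (q.label e) :=
        heq ▸ Finset.mem_filter.2 ⟨heA, rfl⟩
      exact heB (Finset.mem_filter.1 this).1
    refine key (gC - gB) f hfB hfA ?_ (Or.inr ⟨E', hE, Finset.union_subset hBE hCE, gB, hgB,
      fun a ha => ?_⟩)
    · rw [hgB f hfB, hgC e heC, map_add, map_add] at hfcol
      rw [map_add, map_sub, ← add_sub_assoc, ← hfcol, add_sub_cancel_right]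
    · rw [hgC a ha]
      abel

/-- The case that `p` and `p'` have the same blocks, and the labels of `p'` precede those of `p`:
the first block on which the labels differ is merged into the zero block. -/
theorem hasExchange_of_normLabel_lt {p p' q : PrePartition n r} (hp : p.IsAtomic d φ)
    (hp' : p'.IsAtomic d φ) (hpq : p.Refines q) (hp'q : p'.Refines q)
    (hzero : p'.zero = p.zero) (hblocks : p'.blocks = p.blocks)
    (hlt : toLex p'.normLabel < toLex p.normLabel) : p.HasExchange d φ q := by
  obtain ⟨e, hx, he⟩ : ∃ e, (∀ x < e, p'.normLabel x = p.normLabel x) ∧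
    p'.normLabel e < p.normLabel e := hlt
  have hez : e ∉ p.zero := fun h => by
    rw [normLabel_of_mem_zero h, normLabel_of_mem_zero (hzero ▸ h)] at he
    exact lt_irrefl _ he
  obtain ⟨B, hB, heB⟩ := exists_mem_blocks hez
  have hB' : B ∈ p'.blocks := hblocks ▸ hB
  have hBq : B ⊆ q.zero := by
    by_contra hno
    obtain ⟨D, hD, hBD, g, hg⟩ := (hpq.2 B hB).resolve_left hno
    obtain ⟨D', hD', hBD', g', hg'⟩ := (hp'q.2 B hB').resolve_left hno
    refine he.ne (normLabel_eq_of_translate hB hB' (g := g - g') (fun a ha => ?_) heB)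
    rw [eq_sub_of_add_eq (hg' a ha).symm, hg a ha]
    abel
  obtain ⟨z, hz, hzb, hzl⟩ := exists_mergeZero p hB
  have hout : ∀ C ∈ p.blocks, C ≠ B → ∀ a ∈ C, a ∉ B := fun C hC hCB a ha h =>
    hCB (eq_of_mem_blocks hC hB ha h)
  let s : PrePartition n r := ⟨p.zero, p.part, fun a => if a ∈ B then p'.label a else p.label a⟩
  have hsB : ∀ a ∈ B, s.label a = p'.label a + 0 := fun a ha => by
    rw [add_zero]
    exact if_pos ha
  have hsC : ∀ C ∈ p.blocks, C ≠ B → ∀ a ∈ C, s.label a = p.label a + 0 := fun C hC hCB a ha => by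
    rw [add_zero]
    exact if_neg (hout C hC hCB a ha)
  have hnB : ∀ a ∈ B, s.normLabel a = p'.normLabel a := fun a ha =>
    normLabel_eq_of_translate (q := s) hB' hB hsB ha
  refine ⟨s, z, ⟨fun C hC => ?_, hp.2⟩, key_lt_key.2 (Or.inr ⟨rfl, Or.inr ⟨rfl, ?_⟩⟩),
    ⟨p, z, rfl, rfl, Or.inl ⟨B, hB, hz, hzb, by simp [hzl]⟩⟩, ⟨?_, fun C hC => ?_⟩,
    (refines_iff_of_mergeZero hz hzb (by simp [hzl])).2 ⟨hpq, hBq⟩⟩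
  · by_cases hCB : C = B
    · subst hCB
      exact ⟨(hp.1 C hC).1, (hp'.1 C hB').2.translate hsB⟩
    · exact ⟨(hp.1 C hC).1, (hp.1 C hC).2.translate (hsC C hC hCB)⟩
  · refine ⟨e, fun x hxe => ?_, ?_⟩
    · change s.normLabel x = p.normLabel x
      by_cases hxz : x ∈ p.zero
      · rw [normLabel_of_mem_zero hxz, normLabel_of_mem_zero (show x ∈ s.zero from hxz)]
      · obtain ⟨C, hC, hxC⟩ := exists_mem_blocks hxz
        by_cases hCB : C = B
        · rw [hnB x (hCB ▸ hxC), hx x hxe]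
        · exact normLabel_eq_of_translate (q := s) hC hC (hsC C hC hCB) hxC
    · change s.normLabel e < p.normLabel e
      rwa [hnB e heB]
  · rw [hz]
    exact Finset.subset_union_left
  · by_cases hCB : C = B
    · exact Or.inl (by rw [hCB, hz]; exact Finset.subset_union_right)
    · refine Or.inr ⟨C, hzb ▸ Finset.mem_erase.2 ⟨hCB, hC⟩, subset_rfl, 0, fun a ha => ?_⟩
      rw [hsC C hC hCB a ha, hzl]
      abel

theorem hasExchange_of_key_lt [NeZero k] {p p' q : PrePartition n r} (hp : p.IsAtomic d φ)
    (hp' : p'.IsAtomic d φ) (hd : 1 ≤ d) (hpq : p.Refines q) (hp'q : p'.Refines q)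
    (hlt : p'.key < p.key) : p.HasExchange d φ q := by
  rcases key_lt_key.1 hlt with h | ⟨h0, h | ⟨h1, h⟩⟩
  · exact hasExchange_of_zero_lt hp hp' hd hpq hp'q h
  · exact hasExchange_of_blockList_lt hp hp' hd hpq hp'q (Finset.sort_injective h0) h
  · exact hasExchange_of_normLabel_lt hp hp' hpq hp'q (Finset.sort_injective h0)
      (blockList_inj h1) h

end PrePartition

/-! ### The recursive atom ordering -/

/-- The key of a labelled partition, that is, of any of its representatives. -/
noncomputable def DowlingLattice.key {n r : ℕ} (x : DowlingLattice n r) :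
    List (Fin n) ×ₗ List (List (Fin n)) ×ₗ Lex (Fin n → ℕ) :=
  Quotient.lift (fun p : PrePartition n r => p.key)
    (fun _ _ (h : PrePartition.Equivalent _ _) => h.key_eq) x

namespace EvenDowlingLattice

open DowlingLattice

variable {n r d k : ℕ} [NeZero r] [NeZero k]

theorem bot_covBy_iff_exists_isAtomic (hkr : k ∣ r) (hn : 1 ≤ n) (hd : 2 ≤ d) (hkd : k ∣ d)
    {x : EvenDowlingLattice n r d k} :
    ⊥ ⋖ x ↔ ∃ p, mk p = x.1 ∧ p.IsAtomic d (ZMod.castHom hkr (ZMod k)) := by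
  rw [bot_covBy_iff hkr hn (by omega) hkd]
  have hlen : length n d = n / d + 1 := if_neg (by omega)
  constructor
  · intro h
    have hx : x ≠ ⊥ := by
      rintro rfl
      rw [rank_bot] at h
      omega
    obtain ⟨p, hp, hadm⟩ := isAdmissible_of_ne_bot hkr hx
    have hr := rank_add_numBlocks hkr (by omega) hx
    have hb : x.numBlocks = p.blocks.card := (congrArg DowlingLattice.numBlocks hp).symm
    exact ⟨p, hp, hadm, by omega⟩
  · rintro ⟨p, hp, hadm, hcard⟩
    have hx : x ≠ ⊥ := by
      rintro rfl
      exact not_isAdmissible_bot hn hd ⟨p, hp, hadm⟩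
    have hr := rank_add_numBlocks hkr (by omega) hx
    have hb : x.numBlocks = p.blocks.card := (congrArg DowlingLattice.numBlocks hp).symm
    omega

/-- For `d ≥ 2`, every enumeration of the atoms by increasing keys is a recursive atom ordering. -/
theorem isRecursiveAtomOrdering_bot (hkr : k ∣ r) (hn : 1 ≤ n) (hd : 2 ≤ d) (hkd : k ∣ d)
    {t : ℕ} (a : Fin t → EvenDowlingLattice n r d k) (inj : Function.Injective a)
    (atoms : Set.range a = {y | ⊥ ⋖ y}) (hmono : ∀ i j, i ≤ j → (a i).1.key ≤ (a j).1.key) :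
    IsRecursiveAtomOrdering ⊥ a := by
  have hatom : ∀ j, ⊥ ⋖ a j := fun j => by
    have : a j ∈ {y | ⊥ ⋖ y} := atoms ▸ Set.mem_range_self j
    exact this
  have hadm : ∀ j, (a j).1.IsAdmissible d (ZMod.castHom hkr (ZMod k)) := fun j =>
    isAdmissible_of_ne_bot hkr (hatom j).lt.ne'
  refine isRecursiveAtomOrdering_of_forall (bot_ne_top hn) inj atoms
    (fun y hy hyt => isRecursiveAtomOrdering_of_isAdmissible hkr y
      (isAdmissible_of_ne_bot hkr hy.lt.ne') hyt) (fun i j hij y hi hj => ?_)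
  obtain ⟨p, hpj, hp⟩ := (bot_covBy_iff_exists_isAtomic hkr hn hd hkd).1 (hatom j)
  obtain ⟨p', hpi, hp'⟩ := (bot_covBy_iff_exists_isAtomic hkr hn hd hkd).1 (hatom i)
  obtain ⟨q, hq⟩ := exists_mk y.1
  have hkey : p'.key < p.key := by
    have hle := hmono i j hij.le
    rw [← hpi, ← hpj] at hle
    refine lt_of_le_of_ne hle fun heq => ?_
    refine hij.ne (inj (Subtype.ext ?_))
    exact hpi.symm.trans ((mk_eq_mk.2 (PrePartition.equivalent_of_key_eq heq)).trans hpj)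
  obtain ⟨u, z, hu, hup, hM, huz, hzq⟩ :=
    PrePartition.hasExchange_of_key_lt (q := q) hp hp' (by omega)
    (mk_le_mk.1 (by rw [hpj, hq]; exact hj.le)) (mk_le_mk.1 (by rw [hpi, hq]; exact hi.le))
    hkey
  have hM' : Merge (a j).1 (mk z) := hpj ▸ hM
  have hatu : ⊥ ⋖ ofAdmissible hkr (mk u) ⟨u, rfl, hu.1⟩ :=
    (bot_covBy_iff_exists_isAtomic hkr hn hd hkd).2 ⟨u, rfl, hu⟩
  obtain ⟨l, hl⟩ : ofAdmissible hkr (mk u) ⟨u, rfl, hu.1⟩ ∈ Set.range a := atoms ▸ hatu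
  have hl' : (a l).1 = mk u := congrArg Subtype.val hl
  refine ⟨l, ?_, ofAdmissible hkr (mk z) ((hadm j).merge hM'),
    (covBy_iff_merge hkr (hadm j)).2 hM', ?_, ?_⟩
  · by_contra hjl
    have hle := hmono j l (not_lt.1 hjl)
    rw [← hpj, hl'] at hle
    exact (lt_of_lt_of_le hup hle).false
  · rw [lt_iff, hl']
    refine lt_of_le_of_ne (mk_le_mk.2 huz) fun h => ?_
    have h1 : p.blocks.card = z.blocks.card + 1 := hM.numBlocks_eq
    have h2 : u.blocks.card = z.blocks.card := congrArg DowlingLattice.numBlocks h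
    rw [hp.2, ← hu.2] at h1
    omega
  · rw [le_iff, ← hq]
    exact mk_le_mk.2 hzq

end EvenDowlingLattice

theorem mainTheorem3 (n r d k : ℕ) (hn : 1 ≤ n) (hr : 1 ≤ r) (hd : 1 ≤ d)
    (hkr : k ∣ r) (hkd : k ∣ d) :
    IsLatticePoset (EvenDowlingLattice n r d k) ∧
    IsPurePoset (EvenDowlingLattice n r d k) ∧
    (∃ (t : ℕ) (a : Fin t → EvenDowlingLattice n r d k),
      IsRecursiveAtomOrdering ⊥ a ∧ ∀ i j, i ≤ j → (a i).word ≤ (a j).word) ∧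
    Order.height (⊥ : EvenDowlingLattice n r d k) = 0 ∧
    (2 ≤ d → ∀ x : EvenDowlingLattice n r d k, x ≠ ⊥ →
      Order.height x + (x.numBlocks : ℕ∞) = ((n / d + 1 : ℕ) : ℕ∞)) ∧
    (d = 1 → ∀ x : EvenDowlingLattice n r d k, x ≠ ⊥ →
      Order.height x + (x.numBlocks : ℕ∞) = (n : ℕ∞)) := by
  have : NeZero r := ⟨by omega⟩
  have : NeZero k := ⟨by
    rintro rfl
    have := zero_dvd_iff.1 hkr
    omega⟩
  have hmono := EvenDowlingLattice.rank_strictMono (n := n) hkr hd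
  have hgap := EvenDowlingLattice.exists_between_of_rank hkr hn hd hkd
  have hheight := height_eq_of_rank hmono EvenDowlingLattice.rank_bot hgap
  have hrank : ∀ x : EvenDowlingLattice n r d k, x ≠ ⊥ →
      Order.height x + (x.numBlocks : ℕ∞) = (EvenDowlingLattice.length n d : ℕ∞) := fun x hx => by
    rw [hheight, ← EvenDowlingLattice.rank_add_numBlocks hkr hd hx, Nat.cast_add]
  refine ⟨EvenDowlingLattice.isLatticePoset hkr,
    isPurePoset_of_rank hmono EvenDowlingLattice.rank_bot hgap, ?_, Order.height_bot _,
    fun hd2 x hx => ?_, fun hd1 x hx => ?_⟩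
  · by_cases hd1 : d = 1
    · subst hd1
      obtain rfl : k = 1 := Nat.dvd_one.1 hkd
      obtain ⟨t, a, inj, atoms, hword⟩ := exists_monotone_enumeration
        {y : EvenDowlingLattice n r 1 1 | ⊥ ⋖ y} EvenDowlingLattice.word
      refine ⟨t, a, EvenDowlingLattice.isRecursiveAtomOrdering_of_isAdmissible hkr ⊥
        (DowlingLattice.isAdmissible_one _ _) (EvenDowlingLattice.bot_ne_top hn) t a inj atoms,
        hword⟩
    · have hd2 : 2 ≤ d := by omega
      obtain ⟨t, a, inj, atoms, hkey⟩ := exists_monotone_enumeration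
        {y : EvenDowlingLattice n r d k | ⊥ ⋖ y} fun y => y.1.key
      refine ⟨t, a, EvenDowlingLattice.isRecursiveAtomOrdering_bot hkr hn hd2 hkd a inj atoms hkey,
        fun i j hij => ?_⟩
      have hatom : ∀ j, ∃ p, DowlingLattice.mk p = (a j).1 ∧
          p.IsAtomic d (ZMod.castHom hkr (ZMod k)) := fun j =>
        (EvenDowlingLattice.bot_covBy_iff_exists_isAtomic hkr hn hd2 hkd).1
          (show a j ∈ {y | ⊥ ⋖ y} from atoms ▸ Set.mem_range_self j)
      obtain ⟨p, hpi, hp⟩ := hatom i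
      obtain ⟨q, hqj, hq⟩ := hatom j
      have hle := hkey i j hij
      rw [← hpi, ← hqj] at hle
      rw [EvenDowlingLattice.word, EvenDowlingLattice.word, ← hpi, ← hqj]
      exact hp.word_le hq hd hle
  · rw [hrank x hx, EvenDowlingLattice.length, if_neg (by omega)]
  · rw [hrank x hx, EvenDowlingLattice.length, if_pos hd1]
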